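/- For $\eta\in\mathbb{R}$ consider the operator $L(\eta)=-\partial_x^2+(x+\eta)^2$ in $L^2((-\infty,0))$ with the Dirichlet condition $u(0)=0$ or the Neumann condition $u'(0)=0$ at $x=0$. For each of the two conditions its eigenvalues are simple and form a strictly increasing sequence, $\lambda_{\mathsf D,0}(\eta)<\lambda_{\mathsf D,1}(\eta)<\dots$ and $\lambda_{\mathsf N,0}(\eta)<\lambda_{\mathsf N,1}(\eta)<\dots$ respectively. Let $u_n(x)=\upsilon_n(x+\eta)$ denote a corresponding real-valued eigenfunction, so that $\upsilon_n=\upsilon_{\mathsf D,n}$ or $\upsilon_{\mathsf N,n}$ is a function on $(-\infty,\eta]$ depending on $\eta$, normalized by $\int_{-\infty}^\eta|\upsilon_n|^2\,dx=1$; it is unique up to sign. Then for all $n\ge 0$ and $\eta\in\mathbb{R}$ the functions $\lambda_{\mathsf D,n}$ and $\lambda_{\mathsf N,n}$ are differentiable in $\eta$ and the following hold. (1) $\partial_\eta\lambda_{\mathsf D,n}(\eta)=-|\partial_x\upsilon_{\mathsf D,n}(\eta)|^2<0$, where $\partial_x\upsilon_{\mathsf D,n}(\eta)$ is the (one-sided)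 derivative at the endpoint $x=\eta$. (2) $\partial_\eta\lambda_{\mathsf N,n}(\eta)=\bigl(\eta^2-\lambda_{\mathsf N,n}(\eta)\bigr)|\upsilon_{\mathsf N,n}(\eta)|^2$, where $\upsilon_{\mathsf N,n}(\eta)$ is the value at the endpoint $x=\eta$. Moreover $\partial_\eta\lambda_{\mathsf N,n}(\eta)$ is positive, zero or negative if and only if $\lambda_{\mathsf N,n}(\eta)<\eta^2$, $\lambda_{\mathsf N,n}(\eta)=\eta^2$ or $\lambda_{\mathsf N,n}(\eta)>\eta^2$, respectively. (3) $\lambda_{\mathsf N,n}$ has exactly one stationary point $\eta_n$ on $\mathbb{R}$. It is the strict global minimum of $\lambda_{\mathsf N,n}$ and is non-degenerate: $\lambda_{\mathsf N,n}(\eta_n)=\eta_n^2$, and $\lambda_{\mathsf N,n}$ is twice differentiable at $\eta_n$ with $\partial_\eta^2\lambda_{\mathsf N,n}(\eta_n)=2\eta_n|\upsilon_{\mathsf N,n}(\eta_n)|^2>0$, where $\upsilon_{\mathsf N,n}$ is taken for $\eta=\eta_n$. (4) For every $\eta\in\mathbb{R}$, $\lambda_{\mathsf N,n}(\eta)-\eta^2$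 has the same sign (positive, zero or negative) as $\eta_n-\eta$. (5) $\eta_{n+1}>\eta_n$. -/

import Mathlib

open MeasureTheory Set

/-- The two boundary conditions imposed at the endpoint of the half-line. -/
inductive BoundaryCondition where
  | dirichlet
  | neumann

/-- The boundary condition at `0` for a function considered on `(-∞, 0]`:
`u(0) = 0` or `u'(0) = 0` (one-sided derivative). -/
def BoundaryCondition.Holds : BoundaryCondition → (ℝ → ℝ) → Prop
  | .dirichlet, u => u 0 = 0
  | .neumann, u => derivWithin u (Iic 0) 0 = 0

/-- The differential expression `L(η) u = -u'' + (x + η)² u`. -/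
noncomputable def oscL (η : ℝ) (u : ℝ → ℝ) (x : ℝ) : ℝ :=
  -deriv (deriv u) x + (x + η) ^ 2 * u x

/-- `u` is a (real-valued) eigenfunction of `L(η)` in `L²(-∞, 0)`, with the boundary condition
`bc` at `0`, for the eigenvalue `lam`. Only the values of `u` on `(-∞, 0]` matter. -/
structure IsOscEigenfunction (bc : BoundaryCondition) (η lam : ℝ) (u : ℝ → ℝ) : Prop where
  contDiffOn : ContDiffOn ℝ 2 u (Iic 0)
  memLp : MemLp u 2 (volume.restrict (Iic 0))
  equation : ∀ x < 0, oscL η u x = lam * u x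
  boundary : bc.Holds u
  ne_zero : ∃ x ≤ 0, u x ≠ 0

/-- The set of eigenvalues of `L(η)` on `(-∞, 0)` with the boundary condition `bc` at `0`. -/
def oscEigenvalues (bc : BoundaryCondition) (η : ℝ) : Set ℝ :=
  {lam | ∃ u : ℝ → ℝ, IsOscEigenfunction bc η lam u}

/-- The `n`-th eigenvalue (`n = 0, 1, …`) in increasing order: the eigenvalue that has exactly
`n` eigenvalues strictly below it (there is at most one; `sInf` picks it out). -/
noncomputable def oscLambda (bc : BoundaryCondition) (n : ℕ) (η : ℝ) : ℝ :=
  sInf {lam | lam ∈ oscEigenvalues bc η ∧ {mu ∈ oscEigenvalues bc η | mu < lam}.encard = n}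

/-- `υ`, considered on `(-∞, η]`, is a normalized `n`-th eigenfunction in the shifted variable:
`u(x) = υ(x + η)` is an eigenfunction of `L(η)` for the `n`-th eigenvalue, and `‖υ‖ = 1`. -/
def IsNormalizedOscEigenfunction (bc : BoundaryCondition) (n : ℕ) (η : ℝ) (υ : ℝ → ℝ) : Prop :=
  IsOscEigenfunction bc η (oscLambda bc n η) (fun x => υ (x + η)) ∧
    ∫ x in Iic η, υ x ^ 2 = 1

/-! For every real `lam` the equation `u'' = (x² - lam) u` has, up to a factor, one solution that is
square integrable at `-∞`. Multiplying a Weyl fractional integral of a Gaussian derivative by `exp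
(x² / 2)` gives this solution `oscPsi lam` explicitly, with joint continuity in `(lam, x)` and
locally uniform Gaussian decay. After the shift by `η`, eigenfunctions are its multiples
(`isOscEigenfunction_iff`), so eigenvalues are simple and are the zeros in `lam` of `oscPsi lam η`
or `oscPsi' lam η`.

These zeros are counted by a Prüfer angle `θ(lam, x)`, the continuous argument of `oscPsi' + i
oscPsi` on the plane. The Wronskian identity gives `∂θ/∂lam = ‖oscPsi‖² / r² > 0` with `r` the
Prüfer radius, and the equation gives `∂θ/∂x = cos² θ + (lam - x²) sin² θ`. At `lam = 0` the angle
stays in `(0, π / 2)`, and Sturm comparison makes it unbounded as `lam` grows. Hence the `n`-th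
eigenvalue is the unique solution of `θ = π + n π` (Dirichlet) or `θ = π / 2 + n π` (Neumann).

Implicit differentiation yields `∂λ/∂η = -(oscPsi'² + (λ - η²) oscPsi²) / ‖oscPsi‖²`, which contains
both derivative formulas (`hasDerivAt_oscLambda`). In the Neumann case `f = λ - η²` satisfies `f' =
-q f - 2 η` with `q > 0` the squared boundary value. For `η ≤ 0` convexity forces `f > 0`; for `η ≥
0` an integrating factor makes a multiple of `f` strictly decreasing; and `f` cannot stay positive,
since `λ` would then decrease while `η²` is unbounded. So `f` changes sign exactly once, which gives
the stationary point, its minimality and the ordering in `n`. -/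

open Filter Topology

/-! ### Derivatives of the Gaussian -/

/-- The `k`-th derivative of `exp (-z ^ 2)`. -/
noncomputable def gaussD : ℕ → ℝ → ℝ
  | 0, z => Real.exp (-z ^ 2)
  | 1, z => -2 * z * Real.exp (-z ^ 2)
  | (k + 2), z => -2 * z * gaussD (k + 1) z - 2 * (k + 1) * gaussD k z

theorem hasDerivAt_gaussD (k : ℕ) (z : ℝ) : HasDerivAt (gaussD k) (gaussD (k + 1) z) z := by
  have h0 (z : ℝ) : HasDerivAt (fun z : ℝ => Real.exp (-z ^ 2)) (-2 * z * Real.exp (-z ^ 2)) z :=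
    (hasDerivAt_pow 2 z).fun_neg.exp.congr_deriv (by simp; ring)
  induction k using Nat.twoStepInduction generalizing z with
  | zero =>
    have : gaussD 0 = fun z : ℝ => Real.exp (-z ^ 2) := by funext; simp [gaussD]
    rw [this, gaussD.eq_2]
    exact h0 z
  | one =>
    have : gaussD 1 = fun z : ℝ => -2 * z * Real.exp (-z ^ 2) := by funext; simp [gaussD]
    rw [this]
    exact (((hasDerivAt_id z).const_mul (-2)).fun_mul (h0 z)).congr_deriv
      (by simp [gaussD]; ring)
  | more k h1 h2 =>
    have : gaussD (k + 2) = fun z => -2 * z * gaussD (k + 1) z - 2 * (k + 1) * gaussD k z := by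
      funext z; rw [gaussD.eq_3]
    rw [this]
    refine ((((hasDerivAt_id z).const_mul (-2)).fun_mul (h2 z)).fun_sub
      ((h1 z).const_mul (2 * ((k : ℝ) + 1)))).congr_deriv ?_
    rw [gaussD.eq_3 z (k + 1)]; simp; ring

theorem continuous_gaussD (k : ℕ) : Continuous (gaussD k) :=
  continuous_iff_continuousAt.2 fun z => (hasDerivAt_gaussD k z).continuousAt

theorem abs_le_mul_exp_mul_sq {d : ℝ} (hd : 0 < d) (z : ℝ) :
    |z| ≤ (1 + 1 / d) * Real.exp (d * z ^ 2) := by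
  have h1 : d * z ^ 2 + 1 ≤ Real.exp (d * z ^ 2) := Real.add_one_le_exp _
  have h2 : |z| ≤ 1 + z ^ 2 := by
    rw [← sq_abs]; nlinarith [sq_nonneg (|z| - 1), abs_nonneg z]
  have h3 : (1 + 1 / d) * (d * z ^ 2 + 1) = 1 + z ^ 2 + d * z ^ 2 + 1 / d := by
    field_simp; ring
  have h4 : (1 + 1 / d) * (d * z ^ 2 + 1) ≤ (1 + 1 / d) * Real.exp (d * z ^ 2) := by gcongr
  have h5 : 0 < 1 / d := by positivity
  have h6 : 0 ≤ d * z ^ 2 := by positivity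
  linarith

theorem exists_abs_gaussD_le (k : ℕ) :
    ∀ c < (1 : ℝ), ∃ C, 0 ≤ C ∧ ∀ z, |gaussD k z| ≤ C * Real.exp (-c * z ^ 2) := by
  have step : ∀ (f : ℝ → ℝ),
      (∀ c < (1 : ℝ), ∃ C, 0 ≤ C ∧ ∀ z, |f z| ≤ C * Real.exp (-c * z ^ 2)) →
      ∀ c < (1 : ℝ), ∃ C, 0 ≤ C ∧ ∀ z, |-2 * z * f z| ≤ C * Real.exp (-c * z ^ 2) := by
    intro f hf c hc
    obtain ⟨C, hC, h⟩ := hf ((1 + c) / 2) (by linarith)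
    -- Half of the gap between `c` and `1` is kept for the hypothesis on `f`; the other half, `d`,
    -- absorbs the factor `z`.
    set d := (1 - c) / 2 with hd
    have hd0 : 0 < d := by rw [hd]; linarith
    refine ⟨2 * (1 + 1 / d) * C, by positivity, fun z => ?_⟩
    calc |-2 * z * f z| = 2 * |z| * |f z| := by simp [abs_mul]
      _ ≤ 2 * ((1 + 1 / d) * Real.exp (d * z ^ 2)) * (C * Real.exp (-((1 + c) / 2) * z ^ 2)) := by
        gcongr
        · exact abs_le_mul_exp_mul_sq hd0 z
        · exact h z
      _ = 2 * (1 + 1 / d) * C *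
          (Real.exp (d * z ^ 2) * Real.exp (-((1 + c) / 2) * z ^ 2)) := by ring
      _ = _ := by rw [← Real.exp_add]; congr 2; rw [hd]; ring
  have h0 : ∀ c < (1 : ℝ), ∃ C, 0 ≤ C ∧ ∀ z, |gaussD 0 z| ≤ C * Real.exp (-c * z ^ 2) := by
    intro c hc
    refine ⟨1, zero_le_one, fun z => ?_⟩
    simp only [gaussD, Real.abs_exp, one_mul]
    gcongr
    nlinarith [sq_nonneg z]
  induction k using Nat.twoStepInduction with
  | zero => exact h0
  | one => simpa only [gaussD] using step _ h0
  | more k h1 h2 =>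
    intro c hc
    obtain ⟨C1, hC1, h1⟩ := h1 c hc
    obtain ⟨C2, hC2, h2⟩ := step _ h2 c hc
    refine ⟨C2 + 2 * (k + 1) * C1, by positivity, fun z => ?_⟩
    rw [gaussD.eq_3]
    refine (abs_sub _ _).trans ?_
    have : |2 * ((k : ℝ) + 1) * gaussD k z| = 2 * (k + 1) * |gaussD k z| := by
      rw [abs_mul, abs_of_nonneg (by positivity)]
    rw [this, add_mul, mul_assoc _ C1]
    gcongr
    · exact h2 z
    · exact h1 z

/-- In `g⁽ᵏ⁺²⁾ = -2 z g⁽ᵏ⁺¹⁾ - 2 (k + 1) g⁽ᵏ⁾`, half of the first term dominates the second one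
because `z² ≥ 2 (k + 1)` so far to the left. This is what shows that the decaying solution is
positive near `-∞`. -/
theorem gaussD_pos (k : ℕ) (z : ℝ) (hz : z ≤ -(k + 2)) :
    0 < gaussD k z ∧ -z * gaussD k z ≤ gaussD (k + 1) z := by
  induction k with
  | zero =>
    simp at hz
    have := Real.exp_pos (-z ^ 2)
    refine ⟨by simpa [gaussD] using this, ?_⟩
    simp only [gaussD]; nlinarith
  | succ k ih =>
    push_cast at hz
    have hk : (0 : ℝ) ≤ k := k.cast_nonneg
    obtain ⟨h1, h2⟩ := ih (by linarith)
    have h3 : 0 < gaussD (k + 1) z := lt_of_lt_of_le (mul_pos (by linarith) h1) h2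
    refine ⟨h3, ?_⟩
    rw [gaussD.eq_3]
    have h4 : -z * (-z * gaussD k z) ≤ -z * gaussD (k + 1) z :=
      mul_le_mul_of_nonneg_left h2 (by linarith)
    have h5 : (2 * (k + 1)) * gaussD k z ≤ (-z * -z) * gaussD k z := by
      apply mul_le_mul_of_nonneg_right _ h1.le
      nlinarith
    nlinarith

/-! ### Weyl fractional integrals of the Gaussian -/

/-- The Weyl fractional integral `∫₀^∞ t ^ (a - 1) g⁽ᵏ⁾(x - t) dt` of the Gaussian. -/
noncomputable def weylInt (k : ℕ) (a x : ℝ) : ℝ :=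
  ∫ t in Ioi (0 : ℝ), t ^ (a - 1) * gaussD k (x - t)

/-- In `-(3 / 4) (x - t)²` the cross term is at most `(3 / 2) (X² + t² / 4)`. The rate `3 / 4`
exceeds `1 / 2`, so decay in `x` survives the later multiplication by `exp (x² / 2)`. -/
theorem exists_abs_gaussD_sub_le (k : ℕ) : ∃ C, 0 ≤ C ∧ ∀ X, 0 ≤ X → ∀ x ≤ X, ∀ t, 0 < t →
    |gaussD k (x - t)| ≤
      C * Real.exp (3 / 2 * X ^ 2) * Real.exp (-(3 / 4) * x ^ 2) * Real.exp (-(3 / 8) * t ^ 2) := by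
  obtain ⟨C, hC, h⟩ := exists_abs_gaussD_le k (3 / 4) (by norm_num)
  refine ⟨C, hC, fun X hX x hx t ht => (h _).trans ?_⟩
  rw [mul_assoc, mul_assoc, ← Real.exp_add, ← Real.exp_add]
  gcongr
  nlinarith [mul_le_mul_of_nonneg_right hx ht.le, sq_nonneg (X - t / 2)]

theorem integrableOn_rpow_mul_exp {a : ℝ} (ha : 0 < a) :
    IntegrableOn (fun t : ℝ => t ^ (a - 1) * Real.exp (-(3 / 8) * t ^ 2)) (Ioi 0) :=
  integrableOn_rpow_mul_exp_neg_mul_sq (by norm_num) (by linarith)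

theorem aestronglyMeasurable_weyl (k : ℕ) (a x : ℝ) :
    AEStronglyMeasurable (fun t : ℝ => t ^ (a - 1) * gaussD k (x - t))
      (volume.restrict (Ioi 0)) := by
  refine ContinuousOn.aestronglyMeasurable ?_ measurableSet_Ioi
  intro t ht
  have h1 : ContinuousAt (fun t : ℝ => t ^ (a - 1)) t :=
    Real.continuousAt_rpow_const _ _ (Or.inl (ne_of_gt ht))
  have h2 : Continuous fun t => gaussD k (x - t) := (continuous_gaussD k).comp (by fun_prop)
  exact (h1.mul h2.continuousAt).continuousWithinAt

/-- An integrable bound for the integrand of `weylInt`, uniform in `a ∈ [a₀, a₁]` and `x ≤ X`. -/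
theorem weylInt_dominated (k : ℕ) {a₀ a₁ : ℝ} (X : ℝ) (hX : 0 ≤ X) :
    ∃ C, 0 ≤ C ∧ ∀ a ∈ Icc a₀ a₁, ∀ x ≤ X, ∀ t ∈ Ioi (0 : ℝ),
      ‖t ^ (a - 1) * gaussD k (x - t)‖ ≤
        C * Real.exp (-(3 / 4) * x ^ 2) * (t ^ (a₀ - 1) * Real.exp (-(3 / 8) * t ^ 2) +
          t ^ (a₁ - 1) * Real.exp (-(3 / 8) * t ^ 2)) := by
  obtain ⟨C, hC, h⟩ := exists_abs_gaussD_sub_le k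
  refine ⟨C * Real.exp (3 / 2 * X ^ 2), by positivity, fun a ha x hx t ht => ?_⟩
  have ht : 0 < t := ht
  rw [norm_mul, Real.norm_eq_abs, Real.norm_eq_abs, abs_of_pos (Real.rpow_pos_of_pos ht _)]
  have h1 : t ^ (a - 1) ≤ t ^ (a₀ - 1) + t ^ (a₁ - 1) := by
    rcases le_total t 1 with h1 | h1
    · have := Real.rpow_le_rpow_of_exponent_ge ht h1 (show a₀ - 1 ≤ a - 1 by linarith [ha.1])
      linarith [Real.rpow_pos_of_pos ht (a₁ - 1)]
    · have := Real.rpow_le_rpow_of_exponent_le h1 (show a - 1 ≤ a₁ - 1 by linarith [ha.2])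
      linarith [Real.rpow_pos_of_pos ht (a₀ - 1)]
  calc _ ≤ (t ^ (a₀ - 1) + t ^ (a₁ - 1)) * (C * Real.exp (3 / 2 * X ^ 2) *
        Real.exp (-(3 / 4) * x ^ 2) * Real.exp (-(3 / 8) * t ^ 2)) := by
        gcongr
        exact h X hX x hx t ht
    _ = _ := by ring

theorem integrableOn_weyl (k : ℕ) {a : ℝ} (ha : 0 < a) (x : ℝ) :
    IntegrableOn (fun t : ℝ => t ^ (a - 1) * gaussD k (x - t)) (Ioi 0) := by
  obtain ⟨C, hC, h⟩ := weylInt_dominated k (a₀ := a) (a₁ := a) |x| (abs_nonneg x)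
  refine Integrable.mono' (((integrableOn_rpow_mul_exp ha).add
    (integrableOn_rpow_mul_exp ha)).const_mul (C * Real.exp (-(3 / 4) * x ^ 2)))
    (aestronglyMeasurable_weyl k a x) ?_
  exact (ae_restrict_mem measurableSet_Ioi).mono fun t ht =>
    h a ⟨le_rfl, le_rfl⟩ x (le_abs_self x) t ht

theorem exists_abs_weylInt_le (k : ℕ) {a₀ a₁ : ℝ} (h0 : 0 < a₀) (h1 : a₀ ≤ a₁) (X : ℝ) :
    ∃ C, 0 ≤ C ∧ ∀ a ∈ Icc a₀ a₁, ∀ x ≤ X,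
      |weylInt k a x| ≤ C * Real.exp (-(3 / 4) * x ^ 2) := by
  obtain ⟨C, hC, h⟩ := weylInt_dominated k (a₀ := a₀) (a₁ := a₁) |X| (abs_nonneg X)
  set M := ∫ t in Ioi (0 : ℝ), (t ^ (a₀ - 1) * Real.exp (-(3 / 8) * t ^ 2) +
          t ^ (a₁ - 1) * Real.exp (-(3 / 8) * t ^ 2)) with hM
  have hM0 : 0 ≤ M := by
    refine setIntegral_nonneg measurableSet_Ioi fun t ht => ?_
    have ht : 0 < t := ht
    positivity
  have hi := (integrableOn_rpow_mul_exp h0).add (integrableOn_rpow_mul_exp (h0.trans_le h1))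
  refine ⟨C * M, by positivity, fun a ha x hx => ?_⟩
  rw [weylInt, ← Real.norm_eq_abs]
  refine (norm_integral_le_of_norm_le (hi.const_mul (C * Real.exp (-(3 / 4) * x ^ 2)))
    ((ae_restrict_mem measurableSet_Ioi).mono fun t ht =>
      h a ha x (hx.trans (le_abs_self X)) t ht)).trans ?_
  rw [integral_const_mul]
  apply le_of_eq
  simp only [Pi.add_apply]
  rw [← hM]; ring

theorem continuousAt_weylInt (k : ℕ) {a : ℝ} (ha : 0 < a) (x : ℝ) :
    ContinuousAt (fun p : ℝ × ℝ => weylInt k p.1 p.2) (a, x) := by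
  obtain ⟨C, hC, h⟩ := weylInt_dominated k (a₀ := a / 2) (a₁ := a + 1) (|x| + 1) (by positivity)
  have hi := (integrableOn_rpow_mul_exp (half_pos ha)).add
    (integrableOn_rpow_mul_exp (show 0 < a + 1 by linarith))
  unfold weylInt
  refine continuousAt_of_dominated (bound := fun t => C * (t ^ (a / 2 - 1) *
    Real.exp (-(3 / 8) * t ^ 2) + t ^ (a + 1 - 1) * Real.exp (-(3 / 8) * t ^ 2))) ?_ ?_
    (hi.const_mul C) ?_
  · exact Eventually.of_forall fun p => aestronglyMeasurable_weyl k p.1 p.2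
  · have h1 : ∀ᶠ p : ℝ × ℝ in 𝓝 (a, x), p.1 ∈ Icc (a / 2) (a + 1) :=
      continuousAt_fst.eventually_mem (Icc_mem_nhds (by linarith) (by simp))
    have h2 : ∀ᶠ p : ℝ × ℝ in 𝓝 (a, x), p.2 ≤ |x| + 1 :=
      continuousAt_snd.eventually_mem (Iic_mem_nhds (by
        show x < |x| + 1
        linarith [le_abs_self x]))
    filter_upwards [h1, h2] with p hp1 hp2
    refine (ae_restrict_mem measurableSet_Ioi).mono fun t ht =>
      (h p.1 hp1 p.2 hp2 t ht).trans ?_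
    have ht : 0 < t := ht
    apply mul_le_mul_of_nonneg_right _ (by positivity)
    have : Real.exp (-(3 / 4) * p.2 ^ 2) ≤ 1 := Real.exp_le_one_iff.2 (by nlinarith [sq_nonneg p.2])
    nlinarith
  · refine (ae_restrict_mem measurableSet_Ioi).mono fun t ht => ?_
    have ht : 0 < t := ht
    have h1 : ContinuousAt (fun p : ℝ × ℝ => t ^ (p.1 - 1)) (a, x) := by
      have := (Real.continuous_const_rpow ht.ne').comp
        (continuous_fst.sub continuous_const : Continuous fun p : ℝ × ℝ => p.1 - 1)
      exact this.continuousAt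
    have h2 : Continuous fun p : ℝ × ℝ => gaussD k (p.2 - t) :=
      (continuous_gaussD k).comp (by fun_prop)
    exact h1.mul h2.continuousAt

theorem hasDerivAt_weylInt (k : ℕ) {a : ℝ} (ha : 0 < a) (x : ℝ) :
    HasDerivAt (weylInt k a) (weylInt (k + 1) a x) x := by
  obtain ⟨C, hC, h⟩ := weylInt_dominated (k + 1) (a₀ := a) (a₁ := a) (|x| + 1) (by positivity)
  have hi := (integrableOn_rpow_mul_exp ha).add (integrableOn_rpow_mul_exp ha)
  refine (hasDerivAt_integral_of_dominated_loc_of_deriv_le (s := Iic (|x| + 1))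
    (μ := volume.restrict (Ioi 0)) (F := fun x t => t ^ (a - 1) * gaussD k (x - t))
    (bound := fun t => C * (t ^ (a - 1) *
    Real.exp (-(3 / 8) * t ^ 2) + t ^ (a - 1) * Real.exp (-(3 / 8) * t ^ 2)))
    (F' := fun x t => t ^ (a - 1) * gaussD (k + 1) (x - t))
    (Iic_mem_nhds (by linarith [le_abs_self x])) ?_ (integrableOn_weyl k ha x)
    (aestronglyMeasurable_weyl (k + 1) a x) ?_ (hi.const_mul C) ?_).2
  · exact Eventually.of_forall fun y => aestronglyMeasurable_weyl k a y
  · refine (ae_restrict_mem measurableSet_Ioi).mono fun t ht y hy =>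
      (h a ⟨le_rfl, le_rfl⟩ y hy t ht).trans ?_
    have ht : 0 < t := ht
    apply mul_le_mul_of_nonneg_right _ (by positivity)
    have : Real.exp (-(3 / 4) * y ^ 2) ≤ 1 := Real.exp_le_one_iff.2 (by nlinarith [sq_nonneg y])
    nlinarith
  · refine Eventually.of_forall fun t y _ => ?_
    exact ((hasDerivAt_gaussD k (y - t)).comp_sub_const y t).const_mul _

/-- Integration by parts in `t`: the boundary term vanishes at `0` since `a > 0`, and at `∞` since
the product and its derivative are integrable. -/
theorem weylInt_succ_succ_arg (k : ℕ) {a : ℝ} (ha : 0 < a) (x : ℝ) :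
    weylInt (k + 1) (a + 1) x = a * weylInt k a x := by
  have hd : ∀ t ∈ Ioi (0 : ℝ), HasDerivAt (fun t : ℝ => t ^ a * gaussD k (x - t))
      (a * (t ^ (a - 1) * gaussD k (x - t)) - t ^ (a + 1 - 1) * gaussD (k + 1) (x - t)) t := by
    intro t ht
    have ht : 0 < t := ht
    have h1 := Real.hasDerivAt_rpow_const (p := a) (Or.inl ht.ne')
    have h2 : HasDerivAt (fun t => gaussD k (x - t)) (-gaussD (k + 1) (x - t)) t :=
      (hasDerivAt_gaussD k (x - t)).comp_const_sub x t
    exact (h1.fun_mul h2).congr_deriv (by rw [add_sub_cancel_right]; ring)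
  have hi1 := (integrableOn_weyl k ha x).const_mul a
  have hi2 := integrableOn_weyl (k + 1) (show 0 < a + 1 by linarith) x
  have hi0 := integrableOn_weyl k (show 0 < a + 1 by linarith) x
  have hi0' : IntegrableOn (fun t : ℝ => t ^ a * gaussD k (x - t)) (Ioi 0) := by
    simpa using hi0
  have ht := tendsto_zero_of_hasDerivAt_of_integrableOn_Ioi hd (hi1.sub hi2) hi0'
  have hc : ContinuousWithinAt (fun t : ℝ => t ^ a * gaussD k (x - t)) (Ici 0) 0 := by
    have h1 : ContinuousAt (fun t : ℝ => t ^ a) 0 :=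
      Real.continuousAt_rpow_const _ _ (Or.inr ha.le)
    have h2 : Continuous fun t => gaussD k (x - t) := (continuous_gaussD k).comp (by fun_prop)
    exact (h1.mul h2.continuousAt).continuousWithinAt
  have := integral_Ioi_of_hasDerivAt_of_tendsto hc hd (hi1.sub hi2) ht
  rw [integral_sub hi1 hi2, integral_const_mul, Real.zero_rpow ha.ne'] at this
  unfold weylInt
  linarith

/-- The recurrence of `gaussD` at `x - t` produces an extra factor `t`, which raises the order to `a
+ 1`; integration by parts brings it back to `a`. The result is a second-order differential equation
for the Weyl integral. -/
theorem weylInt_add_two (k : ℕ) {a : ℝ} (ha : 0 < a) (x : ℝ) :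
    weylInt (k + 2) a x =
      -2 * x * weylInt (k + 1) a x + (2 * a - 2 * (k + 1)) * weylInt k a x := by
  have hi1 := integrableOn_weyl (k + 1) ha x
  have hi0 := integrableOn_weyl k ha x
  have hi2 := integrableOn_weyl (k + 1) (show 0 < a + 1 by linarith) x
  have : weylInt (k + 2) a x = -2 * x * weylInt (k + 1) a x + 2 * weylInt (k + 1) (a + 1) x
      - 2 * (k + 1) * weylInt k a x := by
    unfold weylInt
    have hadd := integral_add (hi1.const_mul (-2 * x)) (hi2.const_mul 2)
    have hsub := integral_sub ((hi1.const_mul (-2 * x)).add (hi2.const_mul 2))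
      (hi0.const_mul (2 * ((k : ℝ) + 1)))
    simp only [Pi.add_apply] at hsub
    rw [← integral_const_mul, ← integral_const_mul, ← integral_const_mul, ← hadd, ← hsub]
    refine setIntegral_congr_fun measurableSet_Ioi fun t ht => ?_
    have ht : 0 < t := ht
    simp only [gaussD.eq_3]
    rw [show a + 1 - 1 = (a - 1) + 1 by ring, Real.rpow_add_one ht.ne']
    ring
  rw [this, weylInt_succ_succ_arg k ha]
  ring

theorem weylInt_pos (k : ℕ) {a : ℝ} (ha : 0 < a) {x : ℝ} (hx : x ≤ -(k + 2)) :
    0 < weylInt k a x := by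
  have hpos : ∀ t ∈ Ioi (0 : ℝ), 0 < t ^ (a - 1) * gaussD k (x - t) := fun t ht => by
    have ht : 0 < t := ht
    exact mul_pos (Real.rpow_pos_of_pos ht _) (gaussD_pos k _ (by linarith)).1
  rw [weylInt, setIntegral_pos_iff_support_of_nonneg_ae
    ((ae_restrict_mem measurableSet_Ioi).mono fun t ht => (hpos t ht).le)
    (integrableOn_weyl k ha x)]
  have : Ioi (0 : ℝ) ⊆ Function.support (fun t : ℝ => t ^ (a - 1) * gaussD k (x - t)) ∩ Ioi 0 :=
    fun t ht => ⟨(hpos t ht).ne', ht⟩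
  refine lt_of_lt_of_le ?_ (measure_mono this)
  simp

/-! ### The solution decaying at `-∞` -/

/-- `exp (x² / 2)` times the `(k + j)`-th derivative of the Weyl integral of order
`(2 k + 1 - lam) / 2`, normalized so that it does not depend on `k`. -/
noncomputable def oscAux (j k : ℕ) (lam x : ℝ) : ℝ :=
  Real.exp (x ^ 2 / 2) * weylInt (k + j) ((2 * k + 1 - lam) / 2) x /
    Real.Gamma ((2 * k + 1 - lam) / 2)

/-- The solution of `u'' = (x² - lam) u` that decays at `-∞` (a parabolic cylinder function). -/
noncomputable def oscPsi (lam x : ℝ) : ℝ := oscAux 0 ⌈|lam|⌉₊ lam x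

/-- The derivative of `oscPsi lam`. -/
noncomputable def oscPsi' (lam x : ℝ) : ℝ := x * oscPsi lam x + oscAux 1 ⌈|lam|⌉₊ lam x

/-- Raising `k` by one multiplies both the Weyl integral and the Gamma factor by the order `a`.
Hence `k` may be any index with `lam < 2 k + 1`, which makes the integral converge. -/
theorem oscAux_succ (j k : ℕ) {lam : ℝ} (h : lam < 2 * k + 1) (x : ℝ) :
    oscAux j (k + 1) lam x = oscAux j k lam x := by
  have ha : 0 < (2 * k + 1 - lam) / 2 := by linarith
  unfold oscAux
  have e : (2 * ((k + 1 : ℕ) : ℝ) + 1 - lam) / 2 = (2 * k + 1 - lam) / 2 + 1 := by push_cast; ring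
  rw [e, show k + 1 + j = k + j + 1 by ring, weylInt_succ_succ_arg _ ha, Real.Gamma_add_one ha.ne']
  have := (Real.Gamma_pos_of_pos ha).ne'
  generalize (2 * (k : ℝ) + 1 - lam) / 2 = a at *
  field_simp

theorem oscAux_of_le (j : ℕ) {k l : ℕ} (hkl : k ≤ l) {lam : ℝ} (h : lam < 2 * k + 1) (x : ℝ) :
    oscAux j l lam x = oscAux j k lam x := by
  induction l, hkl using Nat.le_induction with
  | base => rfl
  | succ l hl ih =>
    have : (k : ℝ) ≤ l := by exact_mod_cast hl
    rw [oscAux_succ j l (by linarith), ih]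

theorem lt_two_mul_ceil_add_one (lam : ℝ) : lam < 2 * (⌈|lam|⌉₊ : ℝ) + 1 := by
  linarith [Nat.le_ceil |lam|, le_abs_self lam, abs_nonneg lam]

theorem oscAux_ceil (j : ℕ) {k : ℕ} {lam : ℝ} (h : lam < 2 * k + 1) (x : ℝ) :
    oscAux j ⌈|lam|⌉₊ lam x = oscAux j k lam x := by
  rcases le_total k ⌈|lam|⌉₊ with hk | hk
  · exact oscAux_of_le j hk h x
  · exact (oscAux_of_le j hk (lt_two_mul_ceil_add_one lam) x).symm

theorem hasDerivAt_exp_sq_half (x : ℝ) :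
    HasDerivAt (fun x : ℝ => Real.exp (x ^ 2 / 2)) (x * Real.exp (x ^ 2 / 2)) x :=
  ((hasDerivAt_pow 2 x).div_const 2).exp.congr_deriv (by simp; ring)

theorem hasDerivAt_oscAux (j k : ℕ) {lam : ℝ} (h : lam < 2 * k + 1) (x : ℝ) :
    HasDerivAt (oscAux j k lam) (x * oscAux j k lam x + oscAux (j + 1) k lam x) x := by
  have ha : 0 < (2 * k + 1 - lam) / 2 := by linarith
  refine (((hasDerivAt_exp_sq_half x).fun_mul (hasDerivAt_weylInt (k + j) ha x)).div_const
    (Real.Gamma ((2 * k + 1 - lam) / 2))).congr_deriv ?_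
  unfold oscAux
  rw [show k + (j + 1) = k + j + 1 by ring]
  ring

theorem hasDerivAt_oscPsi (lam x : ℝ) : HasDerivAt (oscPsi lam) (oscPsi' lam x) x :=
  hasDerivAt_oscAux 0 _ (lt_two_mul_ceil_add_one lam) x

theorem hasDerivAt_oscPsi' (lam x : ℝ) :
    HasDerivAt (oscPsi' lam) ((x ^ 2 - lam) * oscPsi lam x) x := by
  have h := lt_two_mul_ceil_add_one lam
  have ha : 0 < (2 * (⌈|lam|⌉₊ : ℝ) + 1 - lam) / 2 := by linarith
  refine (((hasDerivAt_id x).fun_mul (hasDerivAt_oscPsi lam x)).fun_add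
    (hasDerivAt_oscAux 1 _ h x)).congr_deriv ?_
  -- The order `a = (2 k + 1 - lam) / 2` is chosen so that `2 a - 2 (k + 1) = -(1 + lam)`, which is
  -- the coefficient that `u = exp (x² / 2) w` requires.
  have : oscAux 2 ⌈|lam|⌉₊ lam x = -2 * x * oscAux 1 ⌈|lam|⌉₊ lam x - (1 + lam) * oscPsi lam x := by
    unfold oscPsi oscAux
    rw [weylInt_add_two _ ha]
    simp only [add_zero]
    ring
  simp only [id, one_mul, one_add_one_eq_two]
  rw [this, oscPsi']
  ring

theorem continuousAt_oscAux (j k : ℕ) {lam : ℝ} (h : lam < 2 * k + 1) (x : ℝ) :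
    ContinuousAt (fun p : ℝ × ℝ => oscAux j k p.1 p.2) (lam, x) := by
  have ha : 0 < (2 * k + 1 - lam) / 2 := by linarith
  have h1 : ContinuousAt (fun p : ℝ × ℝ => ((2 * k + 1 - p.1) / 2, p.2)) (lam, x) := by fun_prop
  have h2 : ContinuousAt (fun p : ℝ × ℝ => weylInt (k + j) ((2 * k + 1 - p.1) / 2) p.2) (lam, x) :=
    ContinuousAt.comp (f := fun p : ℝ × ℝ => ((2 * k + 1 - p.1) / 2, p.2))
      (g := fun p : ℝ × ℝ => weylInt (k + j) p.1 p.2) (continuousAt_weylInt (k + j) ha x) h1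
  have h3 : ContinuousAt (fun p : ℝ × ℝ => Real.Gamma ((2 * k + 1 - p.1) / 2)) (lam, x) := by
    refine ContinuousAt.comp (f := fun p : ℝ × ℝ => (2 * k + 1 - p.1) / 2) (g := Real.Gamma)
      (Real.differentiableAt_Gamma fun m => ?_).continuousAt (by fun_prop)
    have : (0 : ℝ) ≤ m := m.cast_nonneg
    show (2 * k + 1 - lam) / 2 ≠ -(m : ℝ)
    linarith
  have h4 : ContinuousAt (fun p : ℝ × ℝ => Real.exp (p.2 ^ 2 / 2)) (lam, x) := by fun_prop
  exact (h4.mul h2).div h3 (Real.Gamma_pos_of_pos ha).ne'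

/-- The ceiling jumps with `lam`, but near a given `lam` the index can be frozen by independence of
`k`. -/
theorem continuous_oscAux_ceil (j : ℕ) :
    Continuous (fun p : ℝ × ℝ => oscAux j ⌈|p.1|⌉₊ p.1 p.2) := by
  refine continuous_iff_continuousAt.2 fun ⟨lam, x⟩ => ?_
  have h := lt_two_mul_ceil_add_one lam
  refine (continuousAt_oscAux j _ h x).congr ?_
  have : ∀ᶠ p : ℝ × ℝ in 𝓝 (lam, x), p.1 < 2 * (⌈|lam|⌉₊ : ℝ) + 1 :=
    continuousAt_fst.eventually_mem (Iio_mem_nhds h)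
  filter_upwards [this] with p hp
  exact (oscAux_ceil j hp p.2).symm

theorem continuous_oscPsi_uncurry : Continuous (fun p : ℝ × ℝ => oscPsi p.1 p.2) :=
  continuous_oscAux_ceil 0

theorem continuous_oscPsi'_uncurry : Continuous (fun p : ℝ × ℝ => oscPsi' p.1 p.2) :=
  (continuous_snd.mul continuous_oscPsi_uncurry).add (continuous_oscAux_ceil 1)

theorem continuous_oscPsi (lam : ℝ) : Continuous (oscPsi lam) :=
  continuous_oscPsi_uncurry.comp (by fun_prop : Continuous fun x : ℝ => (lam, x))

theorem oscPsi_pos_near_atBot (lam : ℝ) : ∃ R, ∀ x ≤ R, 0 < oscPsi lam x := by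
  have h := lt_two_mul_ceil_add_one lam
  have ha : 0 < (2 * (⌈|lam|⌉₊ : ℝ) + 1 - lam) / 2 := by linarith
  refine ⟨-(⌈|lam|⌉₊ + 2), fun x hx => ?_⟩
  unfold oscPsi oscAux
  have := weylInt_pos (⌈|lam|⌉₊ + 0) ha (x := x) (by simpa using hx)
  have := Real.Gamma_pos_of_pos ha
  positivity

theorem exists_abs_oscAux_le (j : ℕ) (lam X : ℝ) :
    ∃ C, 0 ≤ C ∧ ∀ᶠ mu in 𝓝 lam, ∀ x ≤ X,
      |oscAux j ⌈|mu|⌉₊ mu x| ≤ C * Real.exp (-(1 / 4) * x ^ 2) := by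
  set k := ⌈|lam|⌉₊ with hk
  have h : lam < 2 * (k : ℝ) + 1 := lt_two_mul_ceil_add_one lam
  have ha : 0 < (2 * (k : ℝ) + 1 - lam) / 2 := by linarith
  set a := (2 * (k : ℝ) + 1 - lam) / 2 with hadef
  obtain ⟨C, hC, hb⟩ := exists_abs_weylInt_le (k + j) (half_pos ha)
    (show a / 2 ≤ a + 1 by linarith) X
  have hG : ContinuousAt (fun mu : ℝ => (Real.Gamma ((2 * k + 1 - mu) / 2))⁻¹) lam := by
    refine ContinuousAt.inv₀ (ContinuousAt.comp (f := fun mu : ℝ => (2 * k + 1 - mu) / 2)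
      (g := Real.Gamma) (Real.differentiableAt_Gamma fun m => ?_).continuousAt (by fun_prop)) ?_
    · have : (0 : ℝ) ≤ m := m.cast_nonneg
      show (2 * k + 1 - lam) / 2 ≠ -(m : ℝ)
      linarith
    · exact (Real.Gamma_pos_of_pos ha).ne'
  have hG' : ∀ᶠ mu in 𝓝 lam, (Real.Gamma ((2 * k + 1 - mu) / 2))⁻¹ < (Real.Gamma a)⁻¹ + 1 :=
    hG.eventually_lt continuousAt_const (by rw [hadef]; linarith)
  have hI : ∀ᶠ mu : ℝ in 𝓝 lam, (2 * (k : ℝ) + 1 - mu) / 2 ∈ Icc (a / 2) (a + 1) :=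
    (by fun_prop : ContinuousAt (fun mu : ℝ => (2 * k + 1 - mu) / 2) lam).eventually_mem
      (Icc_mem_nhds (by rw [← hadef]; linarith) (by rw [← hadef]; linarith))
  have hGa := Real.Gamma_pos_of_pos ha
  refine ⟨C * ((Real.Gamma a)⁻¹ + 1), by positivity, ?_⟩
  filter_upwards [hG', hI, Iio_mem_nhds h] with mu h1 h2 h3 x hx
  have h4 : 0 < Real.Gamma ((2 * k + 1 - mu) / 2) :=
    Real.Gamma_pos_of_pos (lt_of_lt_of_le (half_pos ha) h2.1)
  rw [oscAux_ceil j h3, oscAux, div_eq_mul_inv, abs_mul, abs_mul, Real.abs_exp,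
    abs_of_pos (inv_pos.2 h4)]
  calc _ ≤ Real.exp (x ^ 2 / 2) * (C * Real.exp (-(3 / 4) * x ^ 2)) * ((Real.Gamma a)⁻¹ + 1) := by
        gcongr
        exact hb _ h2 x hx
    _ = C * ((Real.Gamma a)⁻¹ + 1) * (Real.exp (x ^ 2 / 2) * Real.exp (-(3 / 4) * x ^ 2)) := by ring
    _ = _ := by rw [← Real.exp_add]; congr 2; ring

theorem exists_oscPsi_le (lam X : ℝ) :
    ∃ C, 0 ≤ C ∧ ∀ᶠ mu in 𝓝 lam, ∀ x ≤ X,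
      |oscPsi mu x| ≤ C * Real.exp (-(1 / 8) * x ^ 2) ∧
      |oscPsi' mu x| ≤ C * Real.exp (-(1 / 8) * x ^ 2) := by
  obtain ⟨C0, hC0, h0⟩ := exists_abs_oscAux_le 0 lam X
  obtain ⟨C1, hC1, h1⟩ := exists_abs_oscAux_le 1 lam X
  -- The factor `x` in `oscPsi'` lowers the rate from `1 / 4` to `1 / 8`, at the cost of the
  -- constant `1 + 1 / (1 / 8) = 9`.
  refine ⟨9 * C0 + C1, by positivity, ?_⟩
  filter_upwards [h0, h1] with mu h0 h1 x hx
  have h0 : |oscPsi mu x| ≤ C0 * Real.exp (-(1 / 4) * x ^ 2) := h0 x hx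
  have h1 := h1 x hx
  have he : Real.exp (-(1 / 4) * x ^ 2) ≤ Real.exp (-(1 / 8) * x ^ 2) := by
    gcongr
    nlinarith [sq_nonneg x]
  have hx' : |x| * Real.exp (-(1 / 4) * x ^ 2) ≤ 9 * Real.exp (-(1 / 8) * x ^ 2) := by
    have := abs_le_mul_exp_mul_sq (show (0 : ℝ) < 1 / 8 by norm_num) x
    calc _ ≤ ((1 + 1 / (1 / 8)) * Real.exp (1 / 8 * x ^ 2)) * Real.exp (-(1 / 4) * x ^ 2) := by
          gcongr
      _ = 9 * (Real.exp (1 / 8 * x ^ 2) * Real.exp (-(1 / 4) * x ^ 2)) := by ring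
      _ = _ := by rw [← Real.exp_add]; congr 2; ring
  have he0 := Real.exp_pos (-(1 / 8) * x ^ 2)
  constructor
  · nlinarith [mul_le_mul_of_nonneg_left he hC0, mul_nonneg hC0 he0.le, mul_nonneg hC1 he0.le]
  · calc |oscPsi' mu x| ≤ |x * oscPsi mu x| + |oscAux 1 ⌈|mu|⌉₊ mu x| := abs_add_le _ _
      _ ≤ |x| * (C0 * Real.exp (-(1 / 4) * x ^ 2)) + C1 * Real.exp (-(1 / 4) * x ^ 2) := by
        rw [abs_mul]; gcongr
      _ ≤ _ := by
        nlinarith [mul_le_mul_of_nonneg_left he hC1, mul_le_mul_of_nonneg_left hx' hC0]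

/-! ### Square integrable solutions: monotonicity and uniqueness -/

theorem not_integrableOn_Iic_of_le {f : ℝ → ℝ} {b c : ℝ} (hc : 0 < c) (hf : ∀ x ≤ b, c ≤ f x) :
    ¬ IntegrableOn f (Iic b) := by
  intro h
  have h1 : IntegrableOn (fun _ : ℝ => c) (Iic b) := by
    refine Integrable.mono' h aestronglyMeasurable_const ?_
    refine (ae_restrict_mem measurableSet_Iic).mono fun x hx => ?_
    rw [Real.norm_eq_abs, abs_of_pos hc]
    exact hf x hx
  rw [integrableOn_const_iff] at h1
  rcases h1 with h1 | h1
  · exact hc.ne' (by simpa using h1)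
  · simp at h1

section Solutions

variable {v v' : ℝ → ℝ} {lam b : ℝ}

/-- The derivative of `v v'` is `v'² + (x² - lam) v²`, a sum of nonnegative terms on this region. -/
theorem monotoneOn_mul_deriv (hv : ∀ x ≤ b, HasDerivAt v (v' x) x)
    (hv' : ∀ x ≤ b, HasDerivAt v' ((x ^ 2 - lam) * v x) x) (hlam : ∀ x < b, lam ≤ x ^ 2) :
    MonotoneOn (fun x => v x * v' x) (Iic b) := by
  have hd : ∀ x ≤ b, HasDerivAt (fun x => v x * v' x) (v' x ^ 2 + (x ^ 2 - lam) * v x ^ 2) x :=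
    fun x hx => ((hv x hx).fun_mul (hv' x hx)).congr_deriv (by ring)
  refine monotoneOn_of_deriv_nonneg (convex_Iic b)
    (fun x hx => (hd x hx).continuousAt.continuousWithinAt)
    (fun x hx => ?_) (fun x hx => ?_)
  · rw [interior_Iic] at hx
    exact (hd x (le_of_lt hx)).differentiableAt.differentiableWithinAt
  · rw [interior_Iic] at hx
    rw [(hd x (le_of_lt hx)).deriv]
    have := hlam x hx
    have : 0 ≤ (x ^ 2 - lam) * v x ^ 2 := mul_nonneg (by linarith) (sq_nonneg _)
    positivity

theorem antitoneOn_sq_of_mul_deriv_nonpos (hv : ∀ x ≤ b, HasDerivAt v (v' x) x)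
    (h : ∀ x ≤ b, v x * v' x ≤ 0) : AntitoneOn (fun x => v x ^ 2) (Iic b) := by
  have hd : ∀ x ≤ b, HasDerivAt (fun x => v x ^ 2) (2 * (v x * v' x)) x :=
    fun x hx => ((hv x hx).fun_pow 2).congr_deriv (by simp; ring)
  refine antitoneOn_of_deriv_nonpos (convex_Iic b)
    (fun x hx => (hd x hx).continuousAt.continuousWithinAt)
    (fun x hx => ?_) (fun x hx => ?_)
  · rw [interior_Iic] at hx
    exact (hd x (le_of_lt hx)).differentiableAt.differentiableWithinAt
  · rw [interior_Iic] at hx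
    rw [(hd x (le_of_lt hx)).deriv]
    linarith [h x (le_of_lt hx)]

theorem monotoneOn_sq_of_mul_deriv_nonneg (hv : ∀ x ≤ b, HasDerivAt v (v' x) x)
    (h : ∀ x ≤ b, 0 ≤ v x * v' x) : MonotoneOn (fun x => v x ^ 2) (Iic b) := by
  have hd : ∀ x ≤ b, HasDerivAt (fun x => v x ^ 2) (2 * (v x * v' x)) x :=
    fun x hx => ((hv x hx).fun_pow 2).congr_deriv (by simp; ring)
  refine monotoneOn_of_deriv_nonneg (convex_Iic b)
    (fun x hx => (hd x hx).continuousAt.continuousWithinAt)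
    (fun x hx => ?_) (fun x hx => ?_)
  · rw [interior_Iic] at hx
    exact (hd x (le_of_lt hx)).differentiableAt.differentiableWithinAt
  · rw [interior_Iic] at hx
    rw [(hd x (le_of_lt hx)).deriv]
    linarith [h x (le_of_lt hx)]

theorem eq_zero_of_mul_deriv_nonpos (hv : ∀ x ≤ b, HasDerivAt v (v' x) x)
    (hint : IntegrableOn (fun x => v x ^ 2) (Iic b)) (h : ∀ x ≤ b, v x * v' x ≤ 0) : v b = 0 := by
  by_contra h0
  refine not_integrableOn_Iic_of_le (by positivity : 0 < v b ^ 2) (fun x hx => ?_) hint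
  exact antitoneOn_sq_of_mul_deriv_nonpos hv h hx self_mem_Iic hx

/-- A square integrable solution of `v'' = (x² - lam) v` grows in absolute value on the region
where `lam ≤ x²`. -/
theorem mul_deriv_nonneg (hv : ∀ x ≤ b, HasDerivAt v (v' x) x)
    (hv' : ∀ x ≤ b, HasDerivAt v' ((x ^ 2 - lam) * v x) x) (hlam : ∀ x < b, lam ≤ x ^ 2)
    (hint : IntegrableOn (fun x => v x ^ 2) (Iic b)) {x : ℝ} (hx : x ≤ b) : 0 ≤ v x * v' x := by
  by_contra hneg
  push Not at hneg
  -- If `v v'` is negative at `x`, it is so on all of `(-∞, x]`. Then `v²` is at least `v x ^ 2`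
  -- there, and integrability forces `v x = 0`.
  have := eq_zero_of_mul_deriv_nonpos (v := v) (v' := v') (fun y hy => hv y (hy.trans hx))
    (hint.mono_set (Iic_subset_Iic.2 hx))
    (fun y hy => (monotoneOn_mul_deriv hv hv' hlam (hy.trans hx) hx hy).trans hneg.le)
  simp [this] at hneg

theorem sq_le_sq_of_le (hv : ∀ x ≤ b, HasDerivAt v (v' x) x)
    (hv' : ∀ x ≤ b, HasDerivAt v' ((x ^ 2 - lam) * v x) x) (hlam : ∀ x < b, lam ≤ x ^ 2)
    (hint : IntegrableOn (fun x => v x ^ 2) (Iic b)) {x : ℝ} (hx : x ≤ b) : v x ^ 2 ≤ v b ^ 2 :=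
  monotoneOn_sq_of_mul_deriv_nonneg hv (fun _ hy => mul_deriv_nonneg hv hv' hlam hint hy) hx
    self_mem_Iic hx

theorem mul_deriv_pos (hv : ∀ x ≤ b, HasDerivAt v (v' x) x)
    (hv' : ∀ x ≤ b, HasDerivAt v' ((x ^ 2 - lam) * v x) x) (hlam : ∀ x < b, lam ≤ x ^ 2)
    (hint : IntegrableOn (fun x => v x ^ 2) (Iic b)) (h0 : ∃ x ≤ b, v x ≠ 0) :
    0 < v b * v' b := by
  rcases (mul_deriv_nonneg hv hv' hlam hint le_rfl).lt_or_eq with h | h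
  · exact h
  · exfalso
    have hb := eq_zero_of_mul_deriv_nonpos hv hint fun x hx =>
      (monotoneOn_mul_deriv hv hv' hlam hx self_mem_Iic hx).trans h.ge
    obtain ⟨x, hx, hx0⟩ := h0
    have := sq_le_sq_of_le hv hv' hlam hint hx
    rw [hb] at this
    have : 0 < v x ^ 2 := by positivity
    linarith

theorem deriv_energy_le {x K : ℝ} (hK : |1 + x ^ 2 - lam| ≤ K) :
    |2 * (v x * v' x) * (1 + x ^ 2 - lam)| ≤ K * (v x ^ 2 + v' x ^ 2) := by
  have h1 : |2 * (v x * v' x)| ≤ v x ^ 2 + v' x ^ 2 := by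
    rw [abs_le]; constructor <;> nlinarith [sq_nonneg (v x - v' x), sq_nonneg (v x + v' x)]
  rw [abs_mul, mul_comm K]
  gcongr

theorem hasDerivAt_energy {x : ℝ} (hv : HasDerivAt v (v' x) x)
    (hv' : HasDerivAt v' ((x ^ 2 - lam) * v x) x) :
    HasDerivAt (fun x => v x ^ 2 + v' x ^ 2) (2 * (v x * v' x) * (1 + x ^ 2 - lam)) x :=
  ((hv.fun_pow 2).fun_add (hv'.fun_pow 2)).congr_deriv (by simp; ring)

/-- A solution with zero Cauchy data at one point of an interval vanishes on it. -/
theorem eq_zero_of_cauchy_zero {s : Set ℝ} (hs : s.OrdConnected)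
    (hv : ∀ x ∈ s, HasDerivAt v (v' x) x)
    (hv' : ∀ x ∈ s, HasDerivAt v' ((x ^ 2 - lam) * v x) x) {a x : ℝ} (ha : a ∈ s) (hx : x ∈ s)
    (h0 : v a = 0) (h0' : v' a = 0) : v x = 0 := by
  suffices h : v x ^ 2 + v' x ^ 2 ≤ 0 by
    have : v x ^ 2 = 0 := by nlinarith [sq_nonneg (v x), sq_nonneg (v' x)]
    simpa using this
  -- Grönwall's argument: `K` bounds the logarithmic growth of the energy `v² + v'²` between `a` and
  -- `x`, so the weight `exp (∓K y)` makes the energy monotone, away from its zero at `a`.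
  set K := 1 + a ^ 2 + x ^ 2 + |lam| with hKdef
  have hsub : uIcc a x ⊆ s := hs.uIcc_subset ha hx
  have hK : ∀ y ∈ uIcc a x, |1 + y ^ 2 - lam| ≤ K := by
    intro y hy
    have : y ^ 2 ≤ a ^ 2 + x ^ 2 := by
      rcases le_total a x with h | h
      · rw [uIcc_of_le h] at hy
        rcases le_total 0 y with h1 | h1
        · nlinarith [hy.2, sq_nonneg a]
        · nlinarith [hy.1, sq_nonneg x]
      · rw [uIcc_of_ge h] at hy
        rcases le_total 0 y with h1 | h1
        · nlinarith [hy.2, sq_nonneg x]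
        · nlinarith [hy.1, sq_nonneg a]
    rw [abs_le, hKdef]
    constructor <;> nlinarith [le_abs_self lam, neg_abs_le lam, sq_nonneg y]
  have hE : ∀ y ∈ uIcc a x, ∀ σ : ℝ, HasDerivAt
      (fun y => (v y ^ 2 + v' y ^ 2) * Real.exp (σ * y))
      ((2 * (v y * v' y) * (1 + y ^ 2 - lam) + σ * (v y ^ 2 + v' y ^ 2)) * Real.exp (σ * y)) y := by
    intro y hy σ
    exact ((hasDerivAt_energy (hv y (hsub hy)) (hv' y (hsub hy))).fun_mul
      ((hasDerivAt_id y).const_mul σ).exp).congr_deriv (by simp; ring)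
  have hEK : ∀ y ∈ uIcc a x, |2 * (v y * v' y) * (1 + y ^ 2 - lam)| ≤ K * (v y ^ 2 + v' y ^ 2) :=
    fun y hy => deriv_energy_le (hK y hy)
  rcases le_total a x with h | h
  · rw [uIcc_of_le h] at hE hEK
    have hanti : AntitoneOn (fun y => (v y ^ 2 + v' y ^ 2) * Real.exp (-K * y)) (Icc a x) := by
      refine antitoneOn_of_deriv_nonpos (convex_Icc a x)
        (fun y hy => (hE y hy _).continuousAt.continuousWithinAt)
        (fun y hy => (hE y (interior_subset hy) _).differentiableAt.differentiableWithinAt)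
        fun y hy => ?_
      rw [(hE y (interior_subset hy) _).deriv]
      refine mul_nonpos_of_nonpos_of_nonneg ?_ (Real.exp_pos _).le
      linarith [(abs_le.1 (hEK y (interior_subset hy))).2]
    have := hanti (left_mem_Icc.2 h) (right_mem_Icc.2 h) h
    simp only [h0, h0'] at this
    have he := Real.exp_pos (-K * x)
    by_contra hc
    push Not at hc
    have := mul_pos hc he
    linarith
  · rw [uIcc_of_ge h] at hE hEK
    have hmono : MonotoneOn (fun y => (v y ^ 2 + v' y ^ 2) * Real.exp (K * y)) (Icc x a) := by
      refine monotoneOn_of_deriv_nonneg (convex_Icc x a)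
        (fun y hy => (hE y hy _).continuousAt.continuousWithinAt)
        (fun y hy => (hE y (interior_subset hy) _).differentiableAt.differentiableWithinAt)
        fun y hy => ?_
      rw [(hE y (interior_subset hy) _).deriv]
      refine mul_nonneg ?_ (Real.exp_pos _).le
      linarith [(abs_le.1 (hEK y (interior_subset hy))).1]
    have := hmono (left_mem_Icc.2 h) (right_mem_Icc.2 h) h
    simp only [h0, h0'] at this
    have he := Real.exp_pos (K * x)
    by_contra hc
    push Not at hc
    have := mul_pos hc he
    linarith

end Solutions

/-! ### Inner products and the Wronskian identity -/

theorem exp_sq_shift_le {M x t : ℝ} (hx : |x| ≤ M) :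
    Real.exp (-(1 / 8) * (x + t) ^ 2) ≤ Real.exp (M ^ 2 / 8) * Real.exp (-(1 / 16) * t ^ 2) := by
  rw [← Real.exp_add]
  gcongr
  have : x ^ 2 ≤ M ^ 2 := sq_le_sq' (abs_le.1 hx).1 (abs_le.1 hx).2
  nlinarith [sq_nonneg (2 * x + t)]

/-- The inner product of `oscPsi lam` and `oscPsi mu` on `(-∞, x]`. -/
noncomputable def oscInner (lam mu x : ℝ) : ℝ :=
  ∫ t in Iic (0 : ℝ), oscPsi lam (x + t) * oscPsi mu (x + t)

theorem exists_abs_mul_oscPsi_le (lam mu x : ℝ) : ∃ C, 0 ≤ C ∧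
    ∀ᶠ p : ℝ × ℝ × ℝ in 𝓝 (lam, mu, x), ∀ t ≤ 0,
      ‖oscPsi p.1 (p.2.2 + t) * oscPsi p.2.1 (p.2.2 + t)‖ ≤
        C * Real.exp (-(1 / 8) * t ^ 2) := by
  obtain ⟨C1, hC1, h1⟩ := exists_oscPsi_le lam (|x| + 1)
  obtain ⟨C2, hC2, h2⟩ := exists_oscPsi_le mu (|x| + 1)
  set M := |x| + 1 with hM
  have e1 : ∀ᶠ p : ℝ × ℝ × ℝ in 𝓝 (lam, mu, x), ∀ x ≤ M,
      |oscPsi p.1 x| ≤ C1 * Real.exp (-(1 / 8) * x ^ 2) ∧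
      |oscPsi' p.1 x| ≤ C1 * Real.exp (-(1 / 8) * x ^ 2) :=
    (continuousAt_fst : ContinuousAt Prod.fst (lam, mu, x)).eventually h1
  have e2 : ∀ᶠ p : ℝ × ℝ × ℝ in 𝓝 (lam, mu, x), ∀ x ≤ M,
      |oscPsi p.2.1 x| ≤ C2 * Real.exp (-(1 / 8) * x ^ 2) ∧
      |oscPsi' p.2.1 x| ≤ C2 * Real.exp (-(1 / 8) * x ^ 2) :=
    (by fun_prop : ContinuousAt (fun p : ℝ × ℝ × ℝ => p.2.1) (lam, mu, x)).eventually h2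
  have e3 : ∀ᶠ p : ℝ × ℝ × ℝ in 𝓝 (lam, mu, x), |p.2.2| < M :=
    (by fun_prop : ContinuousAt (fun p : ℝ × ℝ × ℝ => |p.2.2|) (lam, mu, x)).eventually_lt
      continuousAt_const (by simp [hM])
  refine ⟨C1 * C2 * (Real.exp (M ^ 2 / 8) * Real.exp (M ^ 2 / 8)), by positivity, ?_⟩
  filter_upwards [e1, e2, e3] with p h1 h2 h3 t ht
  have hle : p.2.2 + t ≤ M := by linarith [le_abs_self p.2.2]
  have hs := exp_sq_shift_le (t := t) h3.le
  rw [norm_mul, Real.norm_eq_abs, Real.norm_eq_abs]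
  calc _ ≤ (C1 * (Real.exp (M ^ 2 / 8) * Real.exp (-(1 / 16) * t ^ 2))) *
        (C2 * (Real.exp (M ^ 2 / 8) * Real.exp (-(1 / 16) * t ^ 2))) := by
        gcongr
        · exact (h1 _ hle).1.trans (by gcongr)
        · exact (h2 _ hle).1.trans (by gcongr)
    _ = C1 * C2 * (Real.exp (M ^ 2 / 8) * Real.exp (M ^ 2 / 8)) *
        (Real.exp (-(1 / 16) * t ^ 2) * Real.exp (-(1 / 16) * t ^ 2)) := by ring
    _ = _ := by rw [← Real.exp_add (-(1 / 16) * t ^ 2)]; congr 2; ring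

theorem integrableOn_oscPsi_mul_shift (lam mu x : ℝ) :
    IntegrableOn (fun t => oscPsi lam (x + t) * oscPsi mu (x + t)) (Iic 0) := by
  obtain ⟨C, hC, h⟩ := exists_abs_mul_oscPsi_le lam mu x
  have h := h.self_of_nhds
  refine Integrable.mono' (((integrable_exp_neg_mul_sq (b := 1 / 8) (by norm_num)).const_mul
    C).integrableOn) ?_ ((ae_restrict_mem measurableSet_Iic).mono fun t ht => h t ht)
  exact (((continuous_oscPsi lam).comp (by fun_prop : Continuous fun t => x + t)).mul
    ((continuous_oscPsi mu).comp (by fun_prop : Continuous fun t => x + t))).aestronglyMeasurable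

/-- Shifting by `x` has made the domain of integration fixed, so dominated convergence applies in
all three variables. -/
theorem continuous_oscInner :
    Continuous (fun p : ℝ × ℝ × ℝ => oscInner p.1 p.2.1 p.2.2) := by
  refine continuous_iff_continuousAt.2 fun ⟨lam, mu, x⟩ => ?_
  obtain ⟨C, hC, h⟩ := exists_abs_mul_oscPsi_le lam mu x
  unfold oscInner
  refine continuousAt_of_dominated (bound := fun t => C * Real.exp (-(1 / 8) * t ^ 2)) ?_ ?_
    (((integrable_exp_neg_mul_sq (b := 1 / 8) (by norm_num)).const_mul C).integrableOn) ?_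
  · exact Eventually.of_forall fun p =>
      (integrableOn_oscPsi_mul_shift p.1 p.2.1 p.2.2).aestronglyMeasurable
  · filter_upwards [h] with p hp
    exact (ae_restrict_mem measurableSet_Iic).mono fun t ht => hp t ht
  · refine Eventually.of_forall fun t => Continuous.continuousAt ?_
    exact (continuous_oscPsi_uncurry.comp
        (by fun_prop : Continuous fun p : ℝ × ℝ × ℝ => (p.1, p.2.2 + t))).mul
      (continuous_oscPsi_uncurry.comp
        (by fun_prop : Continuous fun p : ℝ × ℝ × ℝ => (p.2.1, p.2.2 + t)))

theorem integrableOn_oscPsi_mul (lam mu x : ℝ) :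
    IntegrableOn (fun t => oscPsi lam t * oscPsi mu t) (Iic x) := by
  have h := integrableOn_oscPsi_mul_shift lam mu x
  have e : (fun t => x + t) ⁻¹' Iic x = Iic 0 := by ext; simp
  rw [← e] at h
  exact ((measurePreserving_add_left volume x).integrableOn_comp_preimage
    (measurableEmbedding_addLeft x)).1 h

theorem oscInner_eq (lam mu x : ℝ) :
    oscInner lam mu x = ∫ t in Iic x, oscPsi lam t * oscPsi mu t := by
  have e : (fun t => x + t) ⁻¹' Iic x = Iic 0 := by ext; simp
  rw [oscInner, ← e]
  exact (measurePreserving_add_left volume x).setIntegral_preimage_emb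
    (measurableEmbedding_addLeft x) (fun t => oscPsi lam t * oscPsi mu t) (Iic x)

theorem integrableOn_oscPsi_sq (lam x : ℝ) : IntegrableOn (fun t => oscPsi lam t ^ 2) (Iic x) := by
  simpa only [sq] using integrableOn_oscPsi_mul lam lam x

theorem oscInner_self_pos (lam x : ℝ) : 0 < oscInner lam lam x := by
  obtain ⟨R, hR⟩ := oscPsi_pos_near_atBot lam
  rw [oscInner_eq, setIntegral_pos_iff_support_of_nonneg_ae
    (Eventually.of_forall fun t => mul_self_nonneg _) (integrableOn_oscPsi_mul lam lam x)]
  have : Iic (min R x) ⊆ Function.support (fun t => oscPsi lam t * oscPsi lam t) ∩ Iic x :=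
    fun t ht => ⟨(mul_pos (hR t (ht.trans (min_le_left _ _)))
      (hR t (ht.trans (min_le_left _ _)))).ne', mem_Iic.2 (le_trans ht (min_le_right _ _))⟩
  refine lt_of_lt_of_le ?_ (measure_mono this)
  simp

theorem tendsto_exp_neg_sq_atBot {c : ℝ} (hc : 0 < c) :
    Tendsto (fun x : ℝ => Real.exp (-c * x ^ 2)) atBot (𝓝 0) := by
  refine Real.tendsto_exp_atBot.comp ?_
  exact (tendsto_pow_atTop (two_ne_zero)).comp tendsto_neg_atBot_atTop |>.const_mul_atTop_of_neg
    (neg_neg_of_pos hc) |>.congr fun x => by simp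

theorem tendsto_oscPsi_atBot (lam : ℝ) : Tendsto (oscPsi lam) atBot (𝓝 0) := by
  obtain ⟨C, hC, h⟩ := exists_oscPsi_le lam 0
  have h := h.self_of_nhds
  refine squeeze_zero_norm' (a := fun x => C * Real.exp (-(1 / 8) * x ^ 2)) ?_ ?_
  · filter_upwards [eventually_le_atBot 0] with x hx using (h x hx).1
  · simpa using (tendsto_exp_neg_sq_atBot (c := 1 / 8) (by norm_num)).const_mul C

theorem tendsto_oscPsi'_atBot (lam : ℝ) : Tendsto (oscPsi' lam) atBot (𝓝 0) := by
  obtain ⟨C, hC, h⟩ := exists_oscPsi_le lam 0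
  have h := h.self_of_nhds
  refine squeeze_zero_norm' (a := fun x => C * Real.exp (-(1 / 8) * x ^ 2)) ?_ ?_
  · filter_upwards [eventually_le_atBot 0] with x hx using (h x hx).2
  · simpa using (tendsto_exp_neg_sq_atBot (c := 1 / 8) (by norm_num)).const_mul C

/-- The derivative of the Wronskian is `(lam - mu)` times the product of the two solutions, and the
Wronskian vanishes at `-∞`. -/
theorem wronskian_oscPsi (lam mu x : ℝ) :
    oscPsi lam x * oscPsi' mu x - oscPsi' lam x * oscPsi mu x =
      (lam - mu) * oscInner lam mu x := by
  have hd : ∀ y, HasDerivAt (fun y => oscPsi lam y * oscPsi' mu y - oscPsi' lam y * oscPsi mu y)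
      ((lam - mu) * (oscPsi lam y * oscPsi mu y)) y := fun y =>
    (((hasDerivAt_oscPsi lam y).fun_mul (hasDerivAt_oscPsi' mu y)).fun_sub
      ((hasDerivAt_oscPsi' lam y).fun_mul (hasDerivAt_oscPsi mu y))).congr_deriv (by ring)
  have ht : Tendsto (fun y => oscPsi lam y * oscPsi' mu y - oscPsi' lam y * oscPsi mu y) atBot
      (𝓝 0) := by
    simpa using ((tendsto_oscPsi_atBot lam).mul (tendsto_oscPsi'_atBot mu)).sub
      ((tendsto_oscPsi'_atBot lam).mul (tendsto_oscPsi_atBot mu))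
  have := integral_Iic_of_hasDerivAt_of_tendsto (hd x).continuousAt.continuousWithinAt
    (fun y _ => hd y) ((integrableOn_oscPsi_mul lam mu x).const_mul (lam - mu)) ht
  rw [integral_const_mul, ← oscInner_eq] at this
  linarith

theorem oscPsi_sq_add_sq_pos (lam x : ℝ) : 0 < oscPsi lam x ^ 2 + oscPsi' lam x ^ 2 := by
  by_contra h
  have h1 : oscPsi lam x = 0 := by nlinarith [sq_nonneg (oscPsi lam x), sq_nonneg (oscPsi' lam x)]
  have h2 : oscPsi' lam x = 0 := by nlinarith [sq_nonneg (oscPsi lam x), sq_nonneg (oscPsi' lam x)]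
  obtain ⟨R, hR⟩ := oscPsi_pos_near_atBot lam
  have := eq_zero_of_cauchy_zero (lam := lam) ordConnected_univ
    (fun y _ => hasDerivAt_oscPsi lam y)
    (fun y _ => hasDerivAt_oscPsi' lam y) (mem_univ x) (mem_univ R) h1 h2
  exact (hR R le_rfl).ne' this

/-- Square integrable solutions near `-∞` are multiples of `oscPsi lam`. -/
theorem exists_eq_mul_oscPsi {v v' : ℝ → ℝ} {lam b : ℝ} (hv : ∀ x < b, HasDerivAt v (v' x) x)
    (hv' : ∀ x < b, HasDerivAt v' ((x ^ 2 - lam) * v x) x)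
    (hint : MemLp v 2 (volume.restrict (Iic b))) : ∃ c, ∀ x < b, v x = c * oscPsi lam x := by
  obtain ⟨R, hR⟩ := oscPsi_pos_near_atBot lam
  -- Three demands on `a`: `oscPsi lam a` is nonzero, `a` is inside the domain, and `lam ≤ x²` to
  -- the left of `a`. With `c` the ratio of values at `a`, the difference `v - c oscPsi` vanishes at
  -- `a`, hence on `(-∞, a]` by monotonicity of its square.
  set a := min (min R (b - 1)) (-(1 + |lam|)) with ha
  have haR : a ≤ R := (min_le_left _ _).trans (min_le_left _ _)
  have hab : a ≤ b - 1 := (min_le_left _ _).trans (min_le_right _ _)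
  have hal : a ≤ -(1 + |lam|) := min_le_right _ _
  have hlam : ∀ x < a, lam ≤ x ^ 2 := fun x hx => by
    nlinarith [le_abs_self lam, abs_nonneg lam]
  have hpos := hR a haR
  set c := v a / oscPsi lam a with hc
  have hw : ∀ x < b, HasDerivAt (fun x => v x - c * oscPsi lam x) (v' x - c * oscPsi' lam x) x :=
    fun x hx => (hv x hx).fun_sub ((hasDerivAt_oscPsi lam x).const_mul c)
  have hw' : ∀ x < b, HasDerivAt (fun x => v' x - c * oscPsi' lam x)
      ((x ^ 2 - lam) * (v x - c * oscPsi lam x)) x := fun x hx =>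
    ((hv' x hx).fun_sub ((hasDerivAt_oscPsi' lam x).const_mul c)).congr_deriv (by ring)
  have hwint : IntegrableOn (fun x => (v x - c * oscPsi lam x) ^ 2) (Iic a) := by
    have h1 : MemLp (oscPsi lam) 2 (volume.restrict (Iic b)) :=
      (memLp_two_iff_integrable_sq (continuous_oscPsi lam).aestronglyMeasurable).2
        (integrableOn_oscPsi_sq lam b)
    have h2 : MemLp (fun x => v x - c * oscPsi lam x) 2 (volume.restrict (Iic b)) :=
      hint.sub (h1.const_mul c)
    exact IntegrableOn.mono_set (t := Iic b) h2.integrable_sq (Iic_subset_Iic.2 (by linarith))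
  have hwa : v a - c * oscPsi lam a = 0 := by rw [hc]; field_simp; ring
  have hzero : ∀ x ≤ a, v x - c * oscPsi lam x = 0 := fun x hx => by
    have := sq_le_sq_of_le (fun y hy => hw y (by linarith)) (fun y hy => hw' y (by linarith))
      hlam hwint hx
    rw [hwa] at this
    have h3 : (v x - c * oscPsi lam x) ^ 2 = 0 := le_antisymm (by simpa using this) (sq_nonneg _)
    simpa using h3
  have hd0 : v' (a - 1) - c * oscPsi' lam (a - 1) = 0 := by
    refine (hw (a - 1) (by linarith)).unique
      ((hasDerivAt_const (a - 1) (0 : ℝ)).congr_of_eventuallyEq ?_)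
    filter_upwards [Iic_mem_nhds (show a - 1 < a by linarith)] with x hx using hzero x hx
  refine ⟨c, fun x hx => ?_⟩
  have := eq_zero_of_cauchy_zero (s := Iio b) ordConnected_Iio (fun y hy => hw y hy)
    (fun y hy => hw' y hy) (show a - 1 < b by linarith) hx (hzero _ (by linarith)) hd0
  linarith

theorem oscPsi_mul_deriv_pos {lam b : ℝ} (hlam : ∀ x < b, lam ≤ x ^ 2) :
    0 < oscPsi lam b * oscPsi' lam b := by
  obtain ⟨R, hR⟩ := oscPsi_pos_near_atBot lam
  exact mul_deriv_pos (fun x _ => hasDerivAt_oscPsi lam x) (fun x _ => hasDerivAt_oscPsi' lam x)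
    hlam (integrableOn_oscPsi_sq lam b)
    ⟨min R b, min_le_right _ _, (hR _ (min_le_left _ _)).ne'⟩

/-! ### The Prüfer angle and its derivatives -/

/-- At a zero of `f`, continuity of the other factor suffices for the product rule. This avoids
differentiating norms and radii. -/
theorem hasDerivAt_mul_of_eq_zero {f g : ℝ → ℝ} {f' x : ℝ} (hf : HasDerivAt f f' x) (h0 : f x = 0)
    (hg : ContinuousAt g x) : HasDerivAt (fun y => f y * g y) (f' * g x) x := by
  rw [hasDerivAt_iff_tendsto_slope] at hf ⊢
  refine (hf.mul (hg.tendsto.mono_left nhdsWithin_le_nhds)).congr fun y => ?_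
  simp only [slope_def_field, h0]
  ring

/-- The angle is known only as a continuous lift, but the sine of a difference of two angles is an
explicit Wronskian expression; `arcsin` recovers the difference locally. -/
theorem hasDerivAt_of_sin_sub {f : ℝ → ℝ} {f' x : ℝ} (hf : ContinuousAt f x)
    (h : HasDerivAt (fun y => Real.sin (f y - f x)) f' x) : HasDerivAt f f' x := by
  have h1 : HasDerivAt Real.arcsin 1 (Real.sin (f x - f x)) := by
    simpa using Real.hasDerivAt_arcsin (x := 0) (by norm_num) (by norm_num)
  have h2 := (h1.comp x h).const_add (f x)
  rw [one_mul] at h2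
  refine h2.congr_of_eventuallyEq ?_
  have h3 : ∀ᶠ y in 𝓝 x, |f y - f x| < Real.pi / 2 :=
    (by fun_prop : ContinuousAt (fun y => |f y - f x|) x).eventually_lt continuousAt_const
      (by simp [Real.pi_pos])
  filter_upwards [h3] with y hy
  rw [abs_lt] at hy
  simp only [Function.comp]
  rw [Real.arcsin_sin hy.1.le hy.2.le]
  ring

/-- For `lam = 0` the convexity region is the whole line, so the product of solution and derivative
is positive everywhere and neither can change sign. -/
theorem oscPsi_zero_pos (x : ℝ) : 0 < oscPsi 0 x ∧ 0 < oscPsi' 0 x := by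
  have hne (y : ℝ) : 0 < oscPsi 0 y * oscPsi' 0 y := oscPsi_mul_deriv_pos fun z _ => sq_nonneg z
  suffices h : 0 < oscPsi 0 x from ⟨h, pos_of_mul_pos_right (hne x) h.le⟩
  by_contra hx
  push Not at hx
  obtain ⟨R, hR⟩ := oscPsi_pos_near_atBot 0
  have := mem_range_of_exists_le_of_exists_ge (continuous_oscPsi 0) ⟨x, hx⟩ ⟨R, (hR R le_rfl).le⟩
  obtain ⟨y, hy⟩ := this
  simpa [hy] using hne y

theorem exists_oscAngle : ∃ θ : ℝ → ℝ → ℝ, Continuous (fun p : ℝ × ℝ => θ p.1 p.2) ∧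
    (∀ lam x, oscPsi lam x = √(oscPsi lam x ^ 2 + oscPsi' lam x ^ 2) * Real.sin (θ lam x) ∧
      oscPsi' lam x = √(oscPsi lam x ^ 2 + oscPsi' lam x ^ 2) * Real.cos (θ lam x)) ∧
    θ 0 0 ∈ Ioo 0 (Real.pi / 2) := by
  -- The plane is simply connected and `oscPsi' + i oscPsi` never vanishes, so it has a continuous
  -- logarithm; the angle is its imaginary part.
  have hsc : IsSimplyConnected (univ : Set (ℝ × ℝ)) :=
    (Homeomorph.Set.univ (ℝ × ℝ)).toHomotopyEquiv.simplyConnectedSpace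
  obtain ⟨f, hf, hfe⟩ := Complex.exists_continuousOn_eqOn_exp_comp hsc isOpen_univ
    (g := fun p : ℝ × ℝ => (oscPsi' p.1 p.2 : ℂ) + (oscPsi p.1 p.2 : ℂ) * Complex.I)
    (by
      apply Continuous.continuousOn
      have := continuous_oscPsi_uncurry
      have := continuous_oscPsi'_uncurry
      fun_prop)
    (by
      rintro ⟨p, -, hp⟩
      have h1 := congrArg Complex.re hp
      have h2 := congrArg Complex.im hp
      simp at h1 h2
      simpa [h1, h2] using oscPsi_sq_add_sq_pos p.1 p.2)
  rw [continuousOn_univ] at hf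
  have hre : ∀ p : ℝ × ℝ, Real.exp (f p).re * Real.cos (f p).im = oscPsi' p.1 p.2 := fun p => by
    have := congrArg Complex.re (hfe (mem_univ p))
    simpa [Complex.exp_re] using this
  have him : ∀ p : ℝ × ℝ, Real.exp (f p).re * Real.sin (f p).im = oscPsi p.1 p.2 := fun p => by
    have := congrArg Complex.im (hfe (mem_univ p))
    simpa [Complex.exp_im] using this
  have hr : ∀ p : ℝ × ℝ, √(oscPsi p.1 p.2 ^ 2 + oscPsi' p.1 p.2 ^ 2) = Real.exp (f p).re :=
    fun p => by
      rw [← hre, ← him, mul_pow, mul_pow, ← mul_add, Real.sin_sq_add_cos_sq, mul_one]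
      exact Real.sqrt_sq (Real.exp_pos _).le
  -- Removing `m` full turns puts the angle at the origin in `[0, 2 π)`; positivity of its sine and
  -- cosine then places it in `(0, π / 2)`.
  set m := ⌊(f (0, 0)).im / (2 * Real.pi)⌋ with hm
  refine ⟨fun lam x => (f (lam, x)).im - m * (2 * Real.pi), ?_, fun lam x => ?_, ?_⟩
  · exact (Complex.continuous_im.comp hf).sub continuous_const
  · rw [Real.sin_sub_int_mul_two_pi, Real.cos_sub_int_mul_two_pi, hr (lam, x), hre (lam, x),
      him (lam, x)]
    exact ⟨rfl, rfl⟩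
  · have hpi := Real.pi_pos
    have h1 := Int.floor_le ((f (0, 0)).im / (2 * Real.pi))
    have h2 := Int.lt_floor_add_one ((f (0, 0)).im / (2 * Real.pi))
    rw [← hm] at h1 h2
    rw [le_div_iff₀ (by positivity)] at h1
    rw [div_lt_iff₀ (by positivity)] at h2
    have hs : 0 < Real.sin ((f (0, 0)).im - m * (2 * Real.pi)) := by
      rw [Real.sin_sub_int_mul_two_pi]
      have := him (0, 0)
      exact pos_of_mul_pos_right (this ▸ (oscPsi_zero_pos 0).1) (Real.exp_pos _).le
    have hc : 0 < Real.cos ((f (0, 0)).im - m * (2 * Real.pi)) := by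
      rw [Real.cos_sub_int_mul_two_pi]
      have := hre (0, 0)
      exact pos_of_mul_pos_right (this ▸ (oscPsi_zero_pos 0).2) (Real.exp_pos _).le
    show (f (0, 0)).im - m * (2 * Real.pi) ∈ Ioo 0 (Real.pi / 2)
    have ht0 : 0 ≤ (f (0, 0)).im - m * (2 * Real.pi) := by linarith
    have ht1 : (f (0, 0)).im - m * (2 * Real.pi) < 2 * Real.pi := by linarith
    generalize (f (0, 0)).im - m * (2 * Real.pi) = t at hs hc ht0 ht1 ⊢
    have ht2 : t < Real.pi := by
      by_contra h
      push Not at h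
      have := Real.sin_nonneg_of_nonneg_of_le_pi (x := t - Real.pi) (by linarith) (by linarith)
      rw [Real.sin_sub_pi] at this
      linarith
    refine ⟨ht0.lt_of_ne fun h => ?_, ?_⟩
    · rw [← h, Real.sin_zero] at hs
      exact hs.false
    · by_contra h
      push Not at h
      have := Real.cos_nonpos_of_pi_div_two_le_of_le h (by linarith)
      linarith

/-- The Prüfer angle of `oscPsi lam` at `x`. -/
noncomputable def oscAngle : ℝ → ℝ → ℝ := exists_oscAngle.choose

/-- The Prüfer radius of `oscPsi lam` at `x`. -/
noncomputable def oscRadius (lam x : ℝ) : ℝ := √(oscPsi lam x ^ 2 + oscPsi' lam x ^ 2)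

theorem continuous_oscAngle_uncurry : Continuous (fun p : ℝ × ℝ => oscAngle p.1 p.2) :=
  exists_oscAngle.choose_spec.1

theorem continuous_oscAngle (lam : ℝ) : Continuous (oscAngle lam) :=
  continuous_oscAngle_uncurry.comp (by fun_prop : Continuous fun x : ℝ => (lam, x))

theorem continuous_oscAngle_left (x : ℝ) : Continuous (fun lam => oscAngle lam x) :=
  continuous_oscAngle_uncurry.comp (by fun_prop : Continuous fun lam : ℝ => (lam, x))

theorem oscPsi_eq (lam x : ℝ) : oscPsi lam x = oscRadius lam x * Real.sin (oscAngle lam x) :=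
  (exists_oscAngle.choose_spec.2.1 lam x).1

theorem oscPsi'_eq (lam x : ℝ) : oscPsi' lam x = oscRadius lam x * Real.cos (oscAngle lam x) :=
  (exists_oscAngle.choose_spec.2.1 lam x).2

theorem oscRadius_pos (lam x : ℝ) : 0 < oscRadius lam x :=
  Real.sqrt_pos.2 (oscPsi_sq_add_sq_pos lam x)

theorem continuous_oscRadius_uncurry : Continuous (fun p : ℝ × ℝ => oscRadius p.1 p.2) :=
  ((continuous_oscPsi_uncurry.pow 2).add (continuous_oscPsi'_uncurry.pow 2)).sqrt

theorem oscPsi_eq_zero_iff (lam x : ℝ) : oscPsi lam x = 0 ↔ Real.sin (oscAngle lam x) = 0 := by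
  rw [oscPsi_eq, mul_eq_zero, or_iff_right (oscRadius_pos lam x).ne']

theorem oscPsi'_eq_zero_iff (lam x : ℝ) : oscPsi' lam x = 0 ↔ Real.cos (oscAngle lam x) = 0 := by
  rw [oscPsi'_eq, mul_eq_zero, or_iff_right (oscRadius_pos lam x).ne']

attribute [irreducible] oscRadius

theorem sin_oscAngle_sub (lam x mu y : ℝ) :
    Real.sin (oscAngle lam x - oscAngle mu y) =
      (oscPsi lam x * oscPsi' mu y - oscPsi' lam x * oscPsi mu y) *
        (oscRadius lam x * oscRadius mu y)⁻¹ := by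
  have h1 := (oscRadius_pos lam x).ne'
  have h2 := (oscRadius_pos mu y).ne'
  rw [Real.sin_sub, oscPsi_eq lam, oscPsi_eq mu, oscPsi'_eq lam, oscPsi'_eq mu]
  field_simp

/-- By the Wronskian identity, `sin (θ mu - θ lam)` is `mu - lam` times a continuous function of
`mu`, whose value at `lam` is the derivative. -/
theorem hasDerivAt_oscAngle_left (lam x : ℝ) :
    HasDerivAt (fun mu => oscAngle mu x) (oscInner lam lam x / oscRadius lam x ^ 2) lam := by
  refine hasDerivAt_of_sin_sub (continuous_oscAngle_left x).continuousAt ?_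
  have hne : oscRadius lam x * oscRadius lam x ≠ 0 :=
    (mul_pos (oscRadius_pos lam x) (oscRadius_pos lam x)).ne'
  have hg : ContinuousAt (fun mu => oscInner mu lam x * (oscRadius mu x * oscRadius lam x)⁻¹)
      lam := by
    have h1 : Continuous (fun mu => oscInner mu lam x) :=
      continuous_oscInner.comp (by fun_prop : Continuous fun mu : ℝ => (mu, lam, x))
    have h2 : Continuous (fun mu => oscRadius mu x) :=
      Continuous.comp (g := fun p : ℝ × ℝ => oscRadius p.1 p.2)
        continuous_oscRadius_uncurry (by fun_prop : Continuous fun mu : ℝ => (mu, x))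
    have h3 : ContinuousAt (fun mu => oscRadius mu x * oscRadius lam x) lam :=
      (h2.mul continuous_const).continuousAt
    exact h1.continuousAt.mul (h3.inv₀ hne)
  have := hasDerivAt_mul_of_eq_zero ((hasDerivAt_id lam).sub_const lam) (by simp) hg
  refine (this.congr_deriv ?_).congr_of_eventuallyEq (Eventually.of_forall fun mu => ?_)
  · rw [one_mul, sq, div_eq_mul_inv]
  · simp only [sin_oscAngle_sub, wronskian_oscPsi, id]
    ring

theorem hasDerivAt_oscAngle (lam x : ℝ) :
    HasDerivAt (oscAngle lam)
      (Real.cos (oscAngle lam x) ^ 2 + (lam - x ^ 2) * Real.sin (oscAngle lam x) ^ 2) x := by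
  refine hasDerivAt_of_sin_sub (continuous_oscAngle lam).continuousAt ?_
  have hne : oscRadius lam x * oscRadius lam x ≠ 0 :=
    (mul_pos (oscRadius_pos lam x) (oscRadius_pos lam x)).ne'
  have hg : ContinuousAt (fun y => (oscRadius lam y * oscRadius lam x)⁻¹) x := by
    have h2 : Continuous (fun y => oscRadius lam y) :=
      Continuous.comp (g := fun p : ℝ × ℝ => oscRadius p.1 p.2)
        continuous_oscRadius_uncurry (by fun_prop : Continuous fun y : ℝ => (lam, y))
    have h3 : ContinuousAt (fun y => oscRadius lam y * oscRadius lam x) x :=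
      (h2.mul continuous_const).continuousAt
    exact h3.inv₀ hne
  have hd : HasDerivAt (fun y => oscPsi lam y * oscPsi' lam x - oscPsi' lam y * oscPsi lam x)
      (oscPsi' lam x * oscPsi' lam x - (x ^ 2 - lam) * oscPsi lam x * oscPsi lam x) x :=
    ((hasDerivAt_oscPsi lam x).mul_const _).fun_sub ((hasDerivAt_oscPsi' lam x).mul_const _)
  have := hasDerivAt_mul_of_eq_zero hd (by ring) hg
  refine (this.congr_deriv ?_).congr_of_eventuallyEq (Eventually.of_forall fun mu => ?_)
  · have := (oscRadius_pos lam x).ne'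
    rw [oscPsi_eq, oscPsi'_eq]
    field_simp
    ring
  · simp only [sin_oscAngle_sub]

theorem strictMono_oscAngle_left (x : ℝ) : StrictMono (fun lam => oscAngle lam x) := by
  refine strictMono_of_deriv_pos fun lam => ?_
  rw [(hasDerivAt_oscAngle_left lam x).deriv]
  exact div_pos (oscInner_self_pos lam x) (pow_pos (oscRadius_pos lam x) 2)

/-- At `lam = 0` neither sine nor cosine of the angle vanishes, so the angle cannot leave the
quadrant it occupies at `x = 0`. This fixes the numbering of the eigenvalues for all `x` without any
limit at `-∞`. -/
theorem oscAngle_zero_mem (x : ℝ) : oscAngle 0 x ∈ Ioo 0 (Real.pi / 2) := by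
  have h0 := exists_oscAngle.choose_spec.2.2
  have hs (y : ℝ) : Real.sin (oscAngle 0 y) ≠ 0 := fun h =>
    (oscPsi_zero_pos y).1.ne' ((oscPsi_eq_zero_iff 0 y).2 h)
  have hc (y : ℝ) : Real.cos (oscAngle 0 y) ≠ 0 := fun h =>
    (oscPsi_zero_pos y).2.ne' ((oscPsi'_eq_zero_iff 0 y).2 h)
  refine ⟨?_, ?_⟩
  · by_contra h
    push Not at h
    obtain ⟨y, hy⟩ := mem_range_of_exists_le_of_exists_ge (continuous_oscAngle 0) ⟨x, h⟩
      ⟨0, h0.1.le⟩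
    exact hs y (by rw [hy, Real.sin_zero])
  · by_contra h
    push Not at h
    obtain ⟨y, hy⟩ := mem_range_of_exists_le_of_exists_ge (continuous_oscAngle 0) ⟨0, h0.2.le⟩
      ⟨x, h⟩
    exact hc y (by rw [hy, Real.cos_pi_div_two])

/-! ### Sturm comparison and unboundedness of the angle -/

/-- Sturm comparison with `sin (ω (x - a))`. -/
theorem exists_oscPsi_eq_zero {lam a ω : ℝ} (hω : 0 < ω)
    (h : ∀ x ∈ Icc a (a + Real.pi / ω), ω ^ 2 < lam - x ^ 2) :
    ∃ x ∈ Ioo a (a + Real.pi / ω), oscPsi lam x = 0 := by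
  set b := a + Real.pi / ω with hb
  have hab : a < b := by rw [hb]; have := Real.pi_pos; linarith [div_pos this hω]
  have hωb : ω * (b - a) = Real.pi := by rw [hb]; field_simp; ring
  by_contra! hne
  -- If `σ oscPsi` is positive inside the interval, `σ` times the Wronskian expression with the sine
  -- strictly decreases; yet it is nonpositive at the left end and nonnegative at the right end.
  have key : ∀ σ : ℝ, (∀ x ∈ Ioo a b, 0 < σ * oscPsi lam x) → False := by
    intro σ hσ
    have hcl : ∀ x ∈ Icc a b, 0 ≤ σ * oscPsi lam x := by
      intro x hx
      rw [← closure_Ioo hab.ne] at hx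
      exact closure_minimal (fun y hy => (hσ y hy).le)
        (isClosed_le continuous_const (continuous_const.mul (continuous_oscPsi lam))) hx
    have hd : ∀ x, HasDerivAt (fun x => σ * (oscPsi' lam x * Real.sin (ω * (x - a)) -
        oscPsi lam x * (ω * Real.cos (ω * (x - a)))))
        ((x ^ 2 - lam + ω ^ 2) * ((σ * oscPsi lam x) * Real.sin (ω * (x - a)))) x := by
      intro x
      have hl : HasDerivAt (fun x : ℝ => ω * (x - a)) ω x := by
        simpa using ((hasDerivAt_id x).sub_const a).const_mul ω
      exact ((((hasDerivAt_oscPsi' lam x).fun_mul hl.sin).fun_sub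
        ((hasDerivAt_oscPsi lam x).fun_mul (hl.cos.const_mul ω))).const_mul σ).congr_deriv
        (by ring)
    have hanti : StrictAntiOn (fun x => σ * (oscPsi' lam x * Real.sin (ω * (x - a)) -
        oscPsi lam x * (ω * Real.cos (ω * (x - a))))) (Icc a b) := by
      refine strictAntiOn_of_deriv_neg (convex_Icc a b)
        (fun x _ => (hd x).continuousAt.continuousWithinAt) fun x hx => ?_
      rw [(hd x).deriv]
      rw [interior_Icc] at hx
      have h1 := h x (Ioo_subset_Icc_self hx)
      have h2 : 0 < Real.sin (ω * (x - a)) := by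
        refine Real.sin_pos_of_pos_of_lt_pi (mul_pos hω (by linarith [hx.1])) ?_
        rw [← hωb]
        exact mul_lt_mul_of_pos_left (by linarith [hx.2]) hω
      exact mul_neg_of_neg_of_pos (by linarith) (mul_pos (hσ x hx) h2)
    have := hanti (left_mem_Icc.2 hab.le) (right_mem_Icc.2 hab.le) hab
    simp only [hωb, sub_self, mul_zero, Real.sin_zero, Real.cos_zero, Real.sin_pi, Real.cos_pi]
      at this
    have ha := mul_nonneg (hcl a (left_mem_Icc.2 hab.le)) hω.le
    have hb' := mul_nonneg (hcl b (right_mem_Icc.2 hab.le)) hω.le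
    nlinarith
  set c := (a + b) / 2 with hc
  have hcm : c ∈ Ioo a b := ⟨by rw [hc]; linarith, by rw [hc]; linarith⟩
  refine key (oscPsi lam c) fun x hx => ?_
  by_contra! hx0
  have hcont : ContinuousOn (fun x => oscPsi lam c * oscPsi lam x) (Ioo a b) :=
    (continuous_const.mul (continuous_oscPsi lam)).continuousOn
  obtain ⟨y, hy, hy0⟩ := isPreconnected_Ioo.intermediate_value hx hcm hcont
    ⟨hx0, mul_self_nonneg _⟩
  exact (mul_ne_zero (hne c hcm) (hne y hy)) hy0

/-- The angle increases in `x` where `lam > x²`, and at the zero supplied by Sturm comparison it is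
a multiple of `π` exceeding `i π`, hence at least `(i + 1) π`. -/
theorem oscAngle_gt_succ {lam a ω : ℝ} (hω : 0 < ω)
    (h : ∀ x ∈ Icc a (a + Real.pi / ω), ω ^ 2 < lam - x ^ 2) {i : ℕ}
    (hi : i * Real.pi < oscAngle lam a) :
    ((i + 1 : ℕ) : ℝ) * Real.pi < oscAngle lam (a + Real.pi / ω) := by
  have hmono : StrictMonoOn (oscAngle lam) (Icc a (a + Real.pi / ω)) := by
    refine strictMonoOn_of_deriv_pos (convex_Icc _ _) (continuous_oscAngle lam).continuousOn
      fun x hx => ?_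
    rw [(hasDerivAt_oscAngle lam x).deriv]
    have h1 := h x (interior_subset hx)
    have h2 := Real.sin_sq_add_cos_sq (oscAngle lam x)
    have h3 : 0 < lam - x ^ 2 := (pow_pos hω 2).trans h1
    rcases eq_or_ne (Real.sin (oscAngle lam x)) 0 with hs | hs
    · rw [hs] at h2 ⊢
      nlinarith
    · have := mul_pos h3 (by positivity : 0 < Real.sin (oscAngle lam x) ^ 2)
      positivity
  obtain ⟨x, hx, hx0⟩ := exists_oscPsi_eq_zero hω h
  have hab := hx.1.trans hx.2
  obtain ⟨m, hm⟩ := Real.sin_eq_zero_iff.1 ((oscPsi_eq_zero_iff lam x).1 hx0)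
  have h1 := hmono (left_mem_Icc.2 hab.le) (Ioo_subset_Icc_self hx) hx.1
  have h2 := hmono (Ioo_subset_Icc_self hx) (right_mem_Icc.2 hab.le) hx.2
  rw [← hm] at h1 h2
  have h3 : (i : ℝ) < m := lt_of_mul_lt_mul_right (hi.trans h1) Real.pi_pos.le
  have h4 : (i : ℤ) + 1 ≤ m := by exact_mod_cast h3
  have h5 : ((i + 1 : ℕ) : ℝ) ≤ m := by exact_mod_cast h4
  exact (mul_le_mul_of_nonneg_right h5 Real.pi_pos.le).trans_lt h2

theorem exists_lt_oscAngle (x M : ℝ) : ∃ lam, 0 < lam ∧ M < oscAngle lam x := by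
  obtain ⟨N, hN⟩ := exists_nat_gt (M / Real.pi)
  have hpi := Real.pi_pos
  set K : ℕ := N + 1 with hK
  have hK0 : (0 : ℝ) < K := by positivity
  have hω : 0 < K * Real.pi := by positivity
  -- Large enough that `lam - y² > (K π)²` on `[x - 1, x]`. Cutting this interval into `K` pieces of
  -- length `1 / K = π / (K π)`, each piece adds `π` to the lower bound for the angle.
  set lam := (K * Real.pi) ^ 2 + (|x| + 1) ^ 2 + 1 with hlam
  have hlam0 : 0 < lam := by positivity
  have hstep : Real.pi / (K * Real.pi) = 1 / K := by field_simp
  have main : ∀ i : ℕ, i ≤ K → i * Real.pi < oscAngle lam (x - 1 + i / K) := by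
    intro i
    induction i with
    | zero =>
      intro _
      simpa using (oscAngle_zero_mem (x - 1)).1.trans (strictMono_oscAngle_left (x - 1) hlam0)
    | succ i ih =>
      intro hi
      have hi' : ((i : ℝ) + 1) / K ≤ 1 := by
        rw [div_le_one hK0]; exact_mod_cast hi
      have hi0 : (0 : ℝ) ≤ i / K := by positivity
      have := oscAngle_gt_succ hω (lam := lam) (a := x - 1 + i / K) (fun y hy => ?_)
        (ih (by omega))
      · rw [hstep] at this
        convert this using 2
        push_cast; ring
      · rw [hstep] at hy
        have h1 : y ≤ x := by
          have : y ≤ x - 1 + ((i : ℝ) + 1) / K := by rw [add_div, ← add_assoc]; exact hy.2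
          linarith
        have h2 : x - 1 ≤ y := by linarith [hy.1]
        have : y ^ 2 ≤ (|x| + 1) ^ 2 :=
          sq_le_sq' (by linarith [neg_abs_le x]) (by linarith [le_abs_self x])
        rw [hlam]; linarith
  refine ⟨lam, hlam0, ?_⟩
  have := main K le_rfl
  rw [div_self hK0.ne', sub_add_cancel] at this
  refine lt_trans ?_ this
  rw [div_lt_iff₀ hpi] at hN
  have : (N : ℝ) * Real.pi ≤ K * Real.pi := by
    gcongr
    rw [hK]; omega
  linarith

/-! ### Implicit differentiation and enumeration of a discrete set -/

section Abstract

theorem exists_mem_uIcc_sub_eq {f f' : ℝ → ℝ} (h : ∀ x, HasDerivAt f (f' x) x) (a b : ℝ) :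
    ∃ ξ ∈ uIcc a b, f b - f a = f' ξ * (b - a) := by
  have hc : Continuous f := continuous_iff_continuousAt.2 fun x => (h x).continuousAt
  rcases lt_trichotomy a b with hab | hab | hab
  · obtain ⟨ξ, hξ, e⟩ := exists_hasDerivAt_eq_slope f f' hab hc.continuousOn fun x _ => h x
    refine ⟨ξ, Ioo_subset_Icc_self.trans Icc_subset_uIcc hξ, ?_⟩
    rw [e, div_mul_cancel₀ _ (sub_pos.2 hab).ne']
  · exact ⟨a, left_mem_uIcc, by simp [hab]⟩
  · obtain ⟨ξ, hξ, e⟩ := exists_hasDerivAt_eq_slope f f' hab hc.continuousOn fun x _ => h x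
    refine ⟨ξ, Ioo_subset_Icc_self.trans Icc_subset_uIcc' hξ, ?_⟩
    rw [e, div_mul_eq_mul_div, eq_div_iff (sub_pos.2 hab).ne']
    ring

/-- Differentiation of a continuous implicit function in two real variables. -/
theorem hasDerivAt_of_implicit {F K : ℝ → ℝ → ℝ} {g : ℝ → ℝ} {c x₀ r : ℝ}
    (hF : ∀ l x, HasDerivAt (F l) (K l x) x) (hK : Continuous fun p : ℝ × ℝ => K p.1 p.2)
    (hl : HasDerivAt (fun l => F l x₀) r (g x₀)) (hr : r ≠ 0) (hg : ContinuousAt g x₀)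
    (hc : ∀ x, F (g x) x = c) : HasDerivAt g (-K (g x₀) x₀ / r) x₀ := by
  -- The increment from `(g x₀, x₀)` to `(g x, x)` is split at `(g x, x₀)`: the mean value theorem
  -- handles the move in `x`, `dslope` the move in `l`. So differentiability in `l` is needed only
  -- at one point.
  choose ξ hξ hξe using fun x => exists_mem_uIcc_sub_eq (hF (g x)) x₀ x
  have hξt : Tendsto ξ (𝓝 x₀) (𝓝 x₀) := by
    rw [tendsto_iff_dist_tendsto_zero]
    refine squeeze_zero (fun _ => dist_nonneg) (fun x => ?_)
      (tendsto_iff_dist_tendsto_zero.1 (tendsto_id : Tendsto id (𝓝 x₀) (𝓝 x₀)))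
    rw [dist_comm, dist_comm (id x)]
    exact Real.dist_le_of_mem_uIcc left_mem_uIcc (hξ x)
  set D := dslope (fun l => F l x₀) (g x₀) with hD
  have hDc : ContinuousAt D (g x₀) := continuousAt_dslope_same.2 hl.differentiableAt
  have hDr : D (g x₀) = r := by rw [hD, dslope_same, hl.deriv]
  have hDt : Tendsto (fun x => D (g x)) (𝓝 x₀) (𝓝 r) := by
    rw [← hDr]; exact hDc.tendsto.comp hg
  have hKt : Tendsto (fun x => K (g x) (ξ x)) (𝓝 x₀) (𝓝 (K (g x₀) x₀)) :=
    (hK.tendsto (g x₀, x₀)).comp (hg.prodMk_nhds hξt)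
  rw [hasDerivAt_iff_tendsto_slope]
  refine ((hKt.neg.div hDt hr).mono_left nhdsWithin_le_nhds).congr' ?_
  filter_upwards [nhdsWithin_le_nhds (hDt.eventually_ne hr), self_mem_nhdsWithin] with x hx hne
  have h1 : F (g x) x₀ - F (g x₀) x₀ = D (g x) * (g x - g x₀) := by
    have := sub_smul_dslope (fun l => F l x₀) (g x₀) (g x)
    rw [smul_eq_mul] at this
    linarith
  have h2 := hξe x
  rw [hc] at h1 h2
  have h3 : x - x₀ ≠ 0 := sub_ne_zero.2 hne
  rw [slope_def_field, Pi.div_apply, div_eq_div_iff hx h3]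
  linarith

theorem encard_setOf_lt_of_strictMono {e : ℕ → ℝ} (he : StrictMono e) (m : ℕ) :
    {mu ∈ range e | mu < e m}.encard = m := by
  have : {mu ∈ range e | mu < e m} = e '' (Finset.range m : Set ℕ) := by
    ext mu
    constructor
    · rintro ⟨⟨i, rfl⟩, hi⟩
      exact ⟨i, by simpa using he.lt_iff_lt.1 hi, rfl⟩
    · rintro ⟨i, hi, rfl⟩
      exact ⟨⟨i, rfl⟩, he (by simpa using hi)⟩
  rw [this, he.injective.encard_image, encard_coe_eq_coe_finsetCard, Finset.card_range]

theorem sInf_enumeration {e : ℕ → ℝ} (he : StrictMono e) (n : ℕ) :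
    sInf {lam | lam ∈ range e ∧ {mu ∈ range e | mu < lam}.encard = n} = e n := by
  have : {lam | lam ∈ range e ∧ {mu ∈ range e | mu < lam}.encard = n} = {e n} := by
    ext lam
    constructor
    · rintro ⟨⟨i, rfl⟩, hi⟩
      rw [encard_setOf_lt_of_strictMono he] at hi
      have : i = n := by exact_mod_cast hi
      rw [this]; rfl
    · rintro rfl
      exact ⟨⟨n, rfl⟩, encard_setOf_lt_of_strictMono he n⟩
  rw [this, csInf_singleton]

end Abstract

/-! ### Eigenvalues as level sets of the angle -/

/-- The boundary value of `oscPsi lam` at `x`. -/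
noncomputable def oscTrace : BoundaryCondition → ℝ → ℝ → ℝ
  | .dirichlet => oscPsi
  | .neumann => oscPsi'

/-- The Prüfer angle of the lowest eigenfunction at the endpoint. -/
noncomputable def oscBaseAngle : BoundaryCondition → ℝ
  | .dirichlet => Real.pi
  | .neumann => Real.pi / 2

theorem pi_div_two_le_oscBaseAngle (bc : BoundaryCondition) : Real.pi / 2 ≤ oscBaseAngle bc := by
  have := Real.pi_pos
  cases bc <;> simp only [oscBaseAngle] <;> linarith

theorem BoundaryCondition.holds_mul_oscPsi (bc : BoundaryCondition) {c lam η : ℝ} (hc : c ≠ 0)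
    {u : ℝ → ℝ} (hu : EqOn u (fun x => c * oscPsi lam (x + η)) (Iic 0)) :
    bc.Holds u ↔ oscTrace bc lam η = 0 := by
  have h0 : u 0 = c * oscPsi lam η := by simpa using hu (self_mem_Iic : (0 : ℝ) ∈ Iic 0)
  cases bc with
  | dirichlet => simp [BoundaryCondition.Holds, oscTrace, h0, hc]
  | neumann =>
    have hd : HasDerivAt (fun x => c * oscPsi lam (x + η)) (c * oscPsi' lam (0 + η)) 0 :=
      ((hasDerivAt_oscPsi lam (0 + η)).comp_add_const 0 η).const_mul c
    have : derivWithin u (Iic 0) 0 = c * oscPsi' lam η := by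
      rw [derivWithin_congr hu (hu self_mem_Iic),
        hd.hasDerivWithinAt.derivWithin (uniqueDiffOn_Iic 0 0 self_mem_Iic), zero_add]
    simp [BoundaryCondition.Holds, oscTrace, this, hc]

theorem contDiff_oscPsi (lam : ℝ) : ContDiff ℝ 2 (oscPsi lam) := by
  have h1 : deriv (oscPsi lam) = oscPsi' lam := funext fun x => (hasDerivAt_oscPsi lam x).deriv
  have h2 : deriv (oscPsi' lam) = fun x => (x ^ 2 - lam) * oscPsi lam x :=
    funext fun x => (hasDerivAt_oscPsi' lam x).deriv
  have h3 : ContDiff ℝ 1 (oscPsi' lam) := by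
    rw [contDiff_one_iff_deriv, h2]
    refine ⟨fun x => (hasDerivAt_oscPsi' lam x).differentiableAt, ?_⟩
    have := continuous_oscPsi lam
    fun_prop
  rw [show (2 : WithTop ℕ∞) = 1 + 1 by norm_num, contDiff_succ_iff_deriv, h1]
  exact ⟨fun x => (hasDerivAt_oscPsi lam x).differentiableAt, by simp, h3⟩

theorem measurePreserving_add_restrict_Iic (η : ℝ) :
    MeasurePreserving (fun x : ℝ => x + η) (volume.restrict (Iic 0)) (volume.restrict (Iic η)) := by
  have e : (fun x => x + η) ⁻¹' Iic η = Iic 0 := by ext; simp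
  rw [← e]
  exact (measurePreserving_add_right volume η).restrict_preimage measurableSet_Iic

theorem measurePreserving_sub_restrict_Iic (η : ℝ) :
    MeasurePreserving (fun x : ℝ => x - η) (volume.restrict (Iic η)) (volume.restrict (Iic 0)) := by
  have e : (fun x => x - η) ⁻¹' Iic 0 = Iic η := by ext; simp
  rw [← e]
  exact (measurePreserving_sub_right volume η).restrict_preimage measurableSet_Iic

theorem memLp_oscPsi (lam x : ℝ) : MemLp (oscPsi lam) 2 (volume.restrict (Iic x)) :=
  (memLp_two_iff_integrable_sq (continuous_oscPsi lam).aestronglyMeasurable).2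
    (integrableOn_oscPsi_sq lam x)

/-- Eigenfunctions are exactly the nonzero multiples of `oscPsi` with vanishing boundary value. -/
theorem isOscEigenfunction_iff {bc : BoundaryCondition} {η lam : ℝ} {u : ℝ → ℝ} :
    IsOscEigenfunction bc η lam u ↔ oscTrace bc lam η = 0 ∧
      ∃ c, c ≠ 0 ∧ EqOn u (fun x => c * oscPsi lam (x + η)) (Iic 0) := by
  have hcont (c : ℝ) : ContDiff ℝ 2 (fun x => c * oscPsi lam (x + η)) :=
    contDiff_const.mul ((contDiff_oscPsi lam).comp (contDiff_id.add contDiff_const))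
  constructor
  · intro h
    have h2 : ContDiffOn ℝ (1 + 1) u (Iio 0) := by
      have := h.contDiffOn.mono Iio_subset_Iic_self
      rwa [show (2 : WithTop ℕ∞) = 1 + 1 by norm_num] at this
    rw [contDiffOn_succ_iff_deriv_of_isOpen isOpen_Iio] at h2
    have hu : ∀ x < 0, HasDerivAt u (deriv u x) x := fun x hx =>
      (h2.1.differentiableAt (Iio_mem_nhds hx)).hasDerivAt
    have hu' : ∀ x < 0, HasDerivAt (deriv u) (deriv (deriv u) x) x := fun x hx =>
      ((h2.2.2.differentiableOn one_ne_zero).differentiableAt (Iio_mem_nhds hx)).hasDerivAt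
    obtain ⟨c, hc⟩ := exists_eq_mul_oscPsi (v := fun x => u (x - η))
      (v' := fun x => deriv u (x - η)) (lam := lam) (b := η) (fun x hx => (hu (x - η) (by linarith)).comp_sub_const x η)
      (fun x hx => by
        refine ((hu' (x - η) (by linarith)).comp_sub_const x η).congr_deriv ?_
        have := h.equation (x - η) (by linarith)
        rw [oscL, sub_add_cancel] at this
        linarith)
      (h.memLp.comp_measurePreserving (measurePreserving_sub_restrict_Iic η))
    -- The equation holds only on the open half-line; continuity carries the identity to the
    -- endpoint `0`.
    have heq : EqOn u (fun x => c * oscPsi lam (x + η)) (Iic 0) := by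
      refine EqOn.of_subset_closure (s := Iio 0) (fun x hx => ?_) h.contDiffOn.continuousOn
        (hcont c).continuous.continuousOn Iio_subset_Iic_self (by rw [closure_Iio])
      have hx : x < 0 := hx
      simpa using hc (x + η) (by linarith)
    have hc0 : c ≠ 0 := by
      rintro rfl
      obtain ⟨x, hx, hx0⟩ := h.ne_zero
      exact hx0 (by simpa using heq hx)
    exact ⟨(bc.holds_mul_oscPsi hc0 heq).1 h.boundary, c, hc0, heq⟩
  · rintro ⟨h0, c, hc, heq⟩
    refine ⟨(hcont c).contDiffOn.congr heq, ?_, fun x hx => ?_,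
      (bc.holds_mul_oscPsi hc heq).2 h0, ?_⟩
    · have h1 : MemLp (fun x => c * oscPsi lam (x + η)) 2 (volume.restrict (Iic 0)) :=
        ((memLp_oscPsi lam η).comp_measurePreserving
          (measurePreserving_add_restrict_Iic η)).const_mul c
      exact h1.ae_eq ((ae_restrict_mem measurableSet_Iic).mono fun x hx => (heq hx).symm)
    · have hd : ∀ y < 0, HasDerivAt u (c * oscPsi' lam (y + η)) y := fun y hy =>
        (((hasDerivAt_oscPsi lam (y + η)).comp_add_const y η).const_mul c).congr_of_eventuallyEq
          (heq.eventuallyEq_of_mem (Iic_mem_nhds hy))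
      have hd2 : HasDerivAt (deriv u) (c * (((x + η) ^ 2 - lam) * oscPsi lam (x + η))) x := by
        refine (((hasDerivAt_oscPsi' lam (x + η)).comp_add_const x η).const_mul
          c).congr_of_eventuallyEq ?_
        filter_upwards [Iio_mem_nhds hx] with y hy using (hd y hy).deriv
      rw [oscL, hd2.deriv, heq (le_of_lt hx : x ≤ 0)]
      ring
    · obtain ⟨R, hR⟩ := oscPsi_pos_near_atBot lam
      refine ⟨min 0 (R - η), min_le_left _ _, ?_⟩
      rw [heq (min_le_left _ _ : min 0 (R - η) ≤ 0)]
      exact mul_ne_zero hc (hR _ (by linarith [min_le_right 0 (R - η)])).ne'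

theorem mem_oscEigenvalues_iff {bc : BoundaryCondition} {η lam : ℝ} :
    lam ∈ oscEigenvalues bc η ↔ oscTrace bc lam η = 0 :=
  ⟨fun ⟨_, hu⟩ => (isOscEigenfunction_iff.1 hu).1, fun h =>
    ⟨fun x => 1 * oscPsi lam (x + η), isOscEigenfunction_iff.2 ⟨h, 1, one_ne_zero, fun _ _ => rfl⟩⟩⟩

theorem oscTrace_ne_zero {bc : BoundaryCondition} {lam η : ℝ} (h : ∀ x < η, lam ≤ x ^ 2) :
    oscTrace bc lam η ≠ 0 := by
  have := oscPsi_mul_deriv_pos h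
  cases bc with
  | dirichlet => exact left_ne_zero_of_mul this.ne'
  | neumann => exact right_ne_zero_of_mul this.ne'

/-- A vanishing boundary value forces `lam > 0` by convexity, so the angle exceeds its positive
value at `lam = 0`; this excludes the levels below the base angle. -/
theorem oscTrace_eq_zero_iff {bc : BoundaryCondition} {lam η : ℝ} :
    oscTrace bc lam η = 0 ↔ ∃ n : ℕ, oscAngle lam η = oscBaseAngle bc + n * Real.pi := by
  have hpi := Real.pi_pos
  constructor
  · intro h
    have hlam : 0 < lam := by
      by_contra! hl
      exact oscTrace_ne_zero (fun x _ => hl.trans (sq_nonneg x)) h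
    have hpos : 0 < oscAngle lam η :=
      (oscAngle_zero_mem η).1.trans (strictMono_oscAngle_left η hlam)
    cases bc with
    | dirichlet =>
      obtain ⟨m, hm⟩ := Real.sin_eq_zero_iff.1 ((oscPsi_eq_zero_iff lam η).1 h)
      -- The Dirichlet base angle is `π`, so the positive multiple `m π` has index `m - 1`.
      rw [← hm] at hpos
      have hm0 : (0 : ℝ) < m := pos_of_mul_pos_left hpos hpi.le
      have hm1 : 0 < m := by exact_mod_cast hm0
      obtain ⟨k, rfl⟩ := Int.eq_ofNat_of_zero_le hm1.le
      refine ⟨k - 1, ?_⟩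
      have : 1 ≤ k := by omega
      rw [← hm, oscBaseAngle]
      push_cast [this]
      ring
    | neumann =>
      obtain ⟨m, hm⟩ := Real.cos_eq_zero_iff.1 ((oscPsi'_eq_zero_iff lam η).1 h)
      rw [hm] at hpos
      have hm0 : (0 : ℝ) < 2 * m + 1 := by
        by_contra! hneg
        nlinarith
      have hm1 : 0 ≤ m := by
        have : (0 : ℤ) < 2 * m + 1 := by exact_mod_cast hm0
        omega
      obtain ⟨k, rfl⟩ := Int.eq_ofNat_of_zero_le hm1
      refine ⟨k, ?_⟩
      rw [hm, oscBaseAngle]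
      push_cast
      ring
  · rintro ⟨n, hn⟩
    cases bc with
    | dirichlet =>
      refine (oscPsi_eq_zero_iff lam η).2 ?_
      rw [hn, oscBaseAngle, Real.sin_add_nat_mul_pi, Real.sin_pi, mul_zero]
    | neumann =>
      refine (oscPsi'_eq_zero_iff lam η).2 ?_
      rw [hn, oscBaseAngle, Real.cos_add_nat_mul_pi, Real.cos_pi_div_two, mul_zero]

theorem exists_oscAngle_eq (bc : BoundaryCondition) (n : ℕ) (η : ℝ) :
    ∃ lam, oscAngle lam η = oscBaseAngle bc + n * Real.pi := by
  obtain ⟨lam, _, h⟩ := exists_lt_oscAngle η (oscBaseAngle bc + n * Real.pi)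
  have h0 : oscAngle 0 η ≤ oscBaseAngle bc + n * Real.pi := by
    have : 0 ≤ n * Real.pi := by positivity
    linarith [(oscAngle_zero_mem η).2, pi_div_two_le_oscBaseAngle bc]
  exact mem_range_of_exists_le_of_exists_ge (continuous_oscAngle_left η) ⟨0, h0⟩ ⟨lam, h.le⟩

theorem oscLambda_enumeration (bc : BoundaryCondition) (η : ℝ) :
    StrictMono (fun n => oscLambda bc n η) ∧
    range (fun n => oscLambda bc n η) = oscEigenvalues bc η ∧
    ∀ n : ℕ, oscAngle (oscLambda bc n η) η = oscBaseAngle bc + n * Real.pi := by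
  choose e he using fun n => exists_oscAngle_eq bc n η
  have hmono : StrictMono e := fun i j hij => by
    rw [← (strictMono_oscAngle_left η).lt_iff_lt]
    simp only [he]
    have : (i : ℝ) < j := by exact_mod_cast hij
    have := mul_lt_mul_of_pos_right this Real.pi_pos
    linarith
  have hrange : range e = oscEigenvalues bc η := by
    ext lam
    rw [mem_oscEigenvalues_iff, oscTrace_eq_zero_iff]
    constructor
    · rintro ⟨n, rfl⟩
      exact ⟨n, he n⟩
    · rintro ⟨n, hn⟩
      exact ⟨n, (strictMono_oscAngle_left η).injective ((he n).trans hn.symm)⟩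
  have heq : (fun n => oscLambda bc n η) = e := by
    funext n
    rw [oscLambda, ← hrange]
    exact sInf_enumeration hmono n
  refine ⟨heq ▸ hmono, heq ▸ hrange, fun n => ?_⟩
  rw [← he n]
  exact congrArg (fun l => oscAngle l η) (congrFun heq n)

theorem oscAngle_oscLambda (bc : BoundaryCondition) (n : ℕ) (η : ℝ) :
    oscAngle (oscLambda bc n η) η = oscBaseAngle bc + n * Real.pi :=
  (oscLambda_enumeration bc η).2.2 n

theorem oscTrace_oscLambda (bc : BoundaryCondition) (n : ℕ) (η : ℝ) :
    oscTrace bc (oscLambda bc n η) η = 0 :=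
  oscTrace_eq_zero_iff.2 ⟨n, oscAngle_oscLambda bc n η⟩

/-! ### Continuity and derivatives of the eigenvalues -/

/-- Whether `a` lies below or above the eigenvalue is read off from a strict inequality between the
angle at `a` and a fixed level, which persists for nearby endpoints. -/
theorem continuous_oscLambda (bc : BoundaryCondition) (n : ℕ) : Continuous (oscLambda bc n) := by
  refine continuous_iff_continuousAt.2 fun η => tendsto_order.2 ⟨fun a ha => ?_, fun a ha => ?_⟩
  · have h := strictMono_oscAngle_left η ha
    simp only [oscAngle_oscLambda] at h
    filter_upwards [(continuous_oscAngle a).continuousAt.eventually_lt continuousAt_const h]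
      with y hy
    rw [← oscAngle_oscLambda bc n y] at hy
    exact (strictMono_oscAngle_left y).lt_iff_lt.1 hy
  · have h := strictMono_oscAngle_left η ha
    simp only [oscAngle_oscLambda] at h
    filter_upwards [continuousAt_const.eventually_lt (continuous_oscAngle a).continuousAt h]
      with y hy
    rw [← oscAngle_oscLambda bc n y] at hy
    exact (strictMono_oscAngle_left y).lt_iff_lt.1 hy

/-- This is `-(∂θ/∂x) / (∂θ/∂lam)`; the squared radius from the denominator turns sine and cosine
into `oscPsi` and `oscPsi'`. -/
theorem hasDerivAt_oscLambda (bc : BoundaryCondition) (n : ℕ) (η : ℝ) :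
    HasDerivAt (oscLambda bc n)
      (-(oscPsi' (oscLambda bc n η) η ^ 2 +
        (oscLambda bc n η - η ^ 2) * oscPsi (oscLambda bc n η) η ^ 2) /
        oscInner (oscLambda bc n η) (oscLambda bc n η) η) η := by
  have hr := (oscRadius_pos (oscLambda bc n η) η).ne'
  have hN := (oscInner_self_pos (oscLambda bc n η) η).ne'
  have := hasDerivAt_of_implicit (g := oscLambda bc n) (x₀ := η)
    (fun l x => hasDerivAt_oscAngle l x)
    (by
      have := continuous_oscAngle_uncurry
      fun_prop) (hasDerivAt_oscAngle_left (oscLambda bc n η) η)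
    (div_pos (oscInner_self_pos _ η) (pow_pos (oscRadius_pos _ η) 2)).ne'
    (continuous_oscLambda bc n).continuousAt (fun x => oscAngle_oscLambda bc n x)
  refine this.congr_deriv ?_
  rw [oscPsi_eq, oscPsi'_eq]
  field_simp

theorem integral_Iic_mul_oscPsi_sq {c lam η : ℝ} {υ : ℝ → ℝ}
    (h : EqOn υ (fun x => c * oscPsi lam x) (Iic η)) :
    ∫ x in Iic η, υ x ^ 2 = c ^ 2 * oscInner lam lam η := by
  rw [oscInner_eq, ← integral_const_mul]
  refine setIntegral_congr_fun measurableSet_Iic fun x hx => ?_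
  simp only [h hx]
  ring

theorem isNormalizedOscEigenfunction_iff {bc : BoundaryCondition} {n : ℕ} {η : ℝ} {υ : ℝ → ℝ} :
    IsNormalizedOscEigenfunction bc n η υ ↔
      ∃ c, c ^ 2 * oscInner (oscLambda bc n η) (oscLambda bc n η) η = 1 ∧
        EqOn υ (fun x => c * oscPsi (oscLambda bc n η) x) (Iic η) := by
  rw [IsNormalizedOscEigenfunction, isOscEigenfunction_iff]
  have hiff (c : ℝ) : EqOn (fun x => υ (x + η)) (fun x => c * oscPsi (oscLambda bc n η) (x + η))
      (Iic 0) ↔ EqOn υ (fun x => c * oscPsi (oscLambda bc n η) x) (Iic η) := by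
    constructor
    · intro h x hx
      have hx : x ≤ η := hx
      simpa using h (show x - η ≤ 0 by linarith)
    · intro h x hx
      have hx : x ≤ 0 := hx
      exact h (show x + η ≤ η by linarith)
  constructor
  · rintro ⟨⟨-, c, -, h⟩, hn⟩
    rw [hiff] at h
    rw [integral_Iic_mul_oscPsi_sq h] at hn
    exact ⟨c, hn, h⟩
  · rintro ⟨c, hn, h⟩
    refine ⟨⟨oscTrace_oscLambda bc n η, c, ?_, (hiff c).2 h⟩, ?_⟩
    · rintro rfl
      simp at hn
    · rw [integral_Iic_mul_oscPsi_sq h, hn]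

theorem exists_isNormalizedOscEigenfunction (bc : BoundaryCondition) (n : ℕ) (η : ℝ) :
    ∃ υ : ℝ → ℝ, IsNormalizedOscEigenfunction bc n η υ ∧
      ∀ w : ℝ → ℝ, IsNormalizedOscEigenfunction bc n η w →
        EqOn w υ (Iic η) ∨ EqOn w (fun x => -υ x) (Iic η) := by
  set lam := oscLambda bc n η with hlam
  have hN := oscInner_self_pos lam η
  have hc : (√(oscInner lam lam η))⁻¹ ^ 2 * oscInner lam lam η = 1 := by
    rw [inv_pow, Real.sq_sqrt hN.le, inv_mul_cancel₀ hN.ne']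
  refine ⟨fun x => (√(oscInner lam lam η))⁻¹ * oscPsi lam x,
    isNormalizedOscEigenfunction_iff.2 ⟨_, hc, fun _ _ => rfl⟩, fun w hw => ?_⟩
  obtain ⟨d, hd, hwd⟩ := isNormalizedOscEigenfunction_iff.1 hw
  have : d ^ 2 = (√(oscInner lam lam η))⁻¹ ^ 2 :=
    mul_right_cancel₀ hN.ne' (hd.trans hc.symm)
  rcases sq_eq_sq_iff_eq_or_eq_neg.1 this with rfl | rfl
  · exact Or.inl hwd
  · exact Or.inr fun x hx => by rw [hwd hx]; simp [hlam]

theorem hasDerivAt_oscLambda_dirichlet {n : ℕ} {η : ℝ} {υ : ℝ → ℝ}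
    (h : IsNormalizedOscEigenfunction .dirichlet n η υ) :
    HasDerivAt (oscLambda .dirichlet n) (-|derivWithin υ (Iic η) η| ^ 2) η ∧
      -|derivWithin υ (Iic η) η| ^ 2 < 0 := by
  obtain ⟨c, hc, hυ⟩ := isNormalizedOscEigenfunction_iff.1 h
  have h0 : oscPsi (oscLambda .dirichlet n η) η = 0 := oscTrace_oscLambda .dirichlet n η
  have hD := hasDerivAt_oscLambda .dirichlet n η
  set lam := oscLambda .dirichlet n η
  have hN := oscInner_self_pos lam η
  have hd : derivWithin υ (Iic η) η = c * oscPsi' lam η := by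
    rw [derivWithin_congr hυ (hυ self_mem_Iic)]
    exact ((hasDerivAt_oscPsi lam η).const_mul c).hasDerivWithinAt.derivWithin
      (uniqueDiffOn_Iic η η self_mem_Iic)
  have hc0 : c ≠ 0 := by rintro rfl; simp at hc
  have h1 : oscPsi' lam η ≠ 0 := fun h => by simpa [h0, h] using oscPsi_sq_add_sq_pos lam η
  rw [hd, sq_abs]
  refine ⟨hD.congr_deriv ?_, neg_lt_zero.2 (by positivity)⟩
  rw [h0, div_eq_iff hN.ne']
  linear_combination (oscPsi' lam η) ^ 2 * hc

/-! ### The stationary point of a Neumann eigenvalue -/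

/-- The squared boundary value of the normalized Neumann eigenfunction. -/
noncomputable def neumannTraceSq (n : ℕ) (η : ℝ) : ℝ :=
  oscPsi (oscLambda .neumann n η) η ^ 2 /
    oscInner (oscLambda .neumann n η) (oscLambda .neumann n η) η

theorem oscPsi'_oscLambda_neumann (n : ℕ) (η : ℝ) : oscPsi' (oscLambda .neumann n η) η = 0 :=
  oscTrace_oscLambda .neumann n η

theorem neumannTraceSq_pos (n : ℕ) (η : ℝ) : 0 < neumannTraceSq n η := by
  have := oscPsi_sq_add_sq_pos (oscLambda .neumann n η) η
  rw [oscPsi'_oscLambda_neumann] at this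
  exact div_pos (by simpa using this) (oscInner_self_pos _ _)

theorem continuous_neumannTraceSq (n : ℕ) : Continuous (neumannTraceSq n) := by
  have hl := continuous_oscLambda .neumann n
  refine Continuous.div ?_ ?_ fun η => (oscInner_self_pos _ η).ne'
  · exact (continuous_oscPsi_uncurry.comp
      (by fun_prop : Continuous fun η : ℝ => (oscLambda .neumann n η, η))).pow 2
  · exact continuous_oscInner.comp (by fun_prop : Continuous fun η : ℝ =>
      (oscLambda .neumann n η, oscLambda .neumann n η, η))

theorem abs_sq_eq_neumannTraceSq {n : ℕ} {η : ℝ} {υ : ℝ → ℝ}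
    (h : IsNormalizedOscEigenfunction .neumann n η υ) : |υ η| ^ 2 = neumannTraceSq n η := by
  obtain ⟨c, hc, hυ⟩ := isNormalizedOscEigenfunction_iff.1 h
  rw [sq_abs, hυ self_mem_Iic, neumannTraceSq, eq_div_iff (oscInner_self_pos _ _).ne']
  linear_combination (oscPsi (oscLambda .neumann n η) η) ^ 2 * hc

theorem hasDerivAt_oscLambda_neumann (n : ℕ) (η : ℝ) :
    HasDerivAt (oscLambda .neumann n)
      ((η ^ 2 - oscLambda .neumann n η) * neumannTraceSq n η) η := by
  refine (hasDerivAt_oscLambda .neumann n η).congr_deriv ?_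
  rw [oscPsi'_oscLambda_neumann, neumannTraceSq]
  ring

theorem deriv_oscLambda_neumann (n : ℕ) (η : ℝ) : deriv (oscLambda .neumann n) η =
    (η ^ 2 - oscLambda .neumann n η) * neumannTraceSq n η :=
  (hasDerivAt_oscLambda_neumann n η).deriv

/-- For `η ≤ 0`, `lam ≤ η²` would give `lam ≤ x²` on the whole half-line, where the decaying
solution has no vanishing boundary value. -/
theorem sq_lt_oscLambda_neumann_of_nonpos (n : ℕ) {η : ℝ} (hη : η ≤ 0) :
    η ^ 2 < oscLambda .neumann n η := by
  by_contra! h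
  exact oscTrace_ne_zero (fun x hx => h.trans (by nlinarith)) (oscTrace_oscLambda .neumann n η)

theorem exists_sq_eq_oscLambda_neumann (n : ℕ) : ∃ s, 0 < s ∧ oscLambda .neumann n s = s ^ 2 := by
  have hcont : Continuous fun η => oscLambda .neumann n η - η ^ 2 :=
    (continuous_oscLambda .neumann n).sub (by fun_prop)
  have hneg : ∃ η, oscLambda .neumann n η - η ^ 2 ≤ 0 := by
    by_contra! h
    have hanti : StrictAnti (oscLambda .neumann n) := strictAnti_of_deriv_neg fun η => by
      rw [deriv_oscLambda_neumann]
      exact mul_neg_of_neg_of_pos (by linarith [h η]) (neumannTraceSq_pos n η)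
    have h0 := sq_lt_oscLambda_neumann_of_nonpos n (le_refl (0 : ℝ))
    -- The test point `η = λ(0) + 1` satisfies `η² > λ(0) > λ(η)`, against `λ > η²` everywhere.
    have h1 := hanti (show (0 : ℝ) < oscLambda .neumann n 0 + 1 by nlinarith)
    have h2 := h (oscLambda .neumann n 0 + 1)
    nlinarith
  obtain ⟨s, hs⟩ := mem_range_of_exists_le_of_exists_ge hcont hneg
    ⟨0, (sub_pos.2 (sq_lt_oscLambda_neumann_of_nonpos n (le_refl (0 : ℝ)))).le⟩
  have hs : oscLambda .neumann n s = s ^ 2 := sub_eq_zero.1 hs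
  refine ⟨s, ?_, hs⟩
  by_contra! h
  exact (sq_lt_oscLambda_neumann_of_nonpos n h).ne' hs

/-- `oscLambda .neumann n η - η²` times a positive integrating factor decreases strictly for
`η ≥ 0`. -/
theorem exists_strictAntiOn_mul (n : ℕ) : ∃ Q : ℝ → ℝ,
    StrictAntiOn (fun η => (oscLambda .neumann n η - η ^ 2) * Real.exp (Q η)) (Ici 0) := by
  have hq := continuous_neumannTraceSq n
  -- With `f = λ - η²` and `q` the squared boundary value, `f' = -q f - 2 η`; hence `(f exp (∫ q))'
  -- = -2 η exp (∫ q)`.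
  refine ⟨fun η => ∫ t in (0 : ℝ)..η, neumannTraceSq n t, ?_⟩
  have hd : ∀ η, HasDerivAt (fun η => (oscLambda .neumann n η - η ^ 2) *
      Real.exp (∫ t in (0 : ℝ)..η, neumannTraceSq n t))
      (-(2 * η) * Real.exp (∫ t in (0 : ℝ)..η, neumannTraceSq n t)) η := fun η =>
    (((hasDerivAt_oscLambda_neumann n η).fun_sub (hasDerivAt_pow 2 η)).fun_mul
      (hq.integral_hasStrictDerivAt 0 η).hasDerivAt.exp).congr_deriv (by simp; ring)
  refine strictAntiOn_of_deriv_neg (convex_Ici 0)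
    (fun η _ => (hd η).continuousAt.continuousWithinAt) fun η hη => ?_
  rw [interior_Ici] at hη
  have hη : 0 < η := hη
  rw [(hd η).deriv]
  exact mul_neg_of_neg_of_pos (by linarith) (Real.exp_pos _)

theorem oscLambda_neumann_sub_sq_sign {n : ℕ} {s : ℝ} (hs0 : 0 < s)
    (hs : oscLambda .neumann n s = s ^ 2) (η : ℝ) :
    (η < s → η ^ 2 < oscLambda .neumann n η) ∧ (s < η → oscLambda .neumann n η < η ^ 2) := by
  obtain ⟨Q, hQ⟩ := exists_strictAntiOn_mul n
  refine ⟨fun h => ?_, fun h => ?_⟩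
  · rcases le_total η 0 with h0 | h0
    · exact sq_lt_oscLambda_neumann_of_nonpos n h0
    · have := hQ h0 hs0.le h
      simp only [hs, sub_self, zero_mul] at this
      exact sub_pos.1 (pos_of_mul_pos_left this (Real.exp_pos _).le)
  · have := hQ hs0.le (hs0.trans h).le h
    simp only [hs, sub_self, zero_mul] at this
    exact sub_neg.1 (neg_of_mul_neg_left this (Real.exp_pos _).le)

theorem deriv_oscLambda_neumann_sign (n : ℕ) (η : ℝ) :
    (0 < deriv (oscLambda .neumann n) η ↔ oscLambda .neumann n η < η ^ 2) ∧
    (deriv (oscLambda .neumann n) η = 0 ↔ oscLambda .neumann n η = η ^ 2) ∧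
    (deriv (oscLambda .neumann n) η < 0 ↔ η ^ 2 < oscLambda .neumann n η) := by
  have hq := neumannTraceSq_pos n η
  rw [deriv_oscLambda_neumann]
  refine ⟨?_, ?_, ?_⟩
  · rw [mul_pos_iff_of_pos_right hq, sub_pos]
  · rw [mul_eq_zero, or_iff_left hq.ne', sub_eq_zero, eq_comm]
  · exact ⟨fun h => sub_neg.1 (neg_of_mul_neg_left h hq.le),
      fun h => mul_neg_of_neg_of_pos (sub_neg.2 h) hq⟩

theorem oscLambda_neumann_lt_of_ne {n : ℕ} {s : ℝ} (hs0 : 0 < s)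
    (hs : oscLambda .neumann n s = s ^ 2) {η : ℝ} (hη : η ≠ s) :
    oscLambda .neumann n s < oscLambda .neumann n η := by
  have hc := (continuous_oscLambda .neumann n).continuousOn (s := univ)
  rcases hη.lt_or_gt with h | h
  · refine strictAntiOn_of_deriv_neg (convex_Iic s) (hc.mono (subset_univ _)) (fun x hx => ?_)
      h.le self_mem_Iic h
    rw [interior_Iic] at hx
    exact (deriv_oscLambda_neumann_sign n x).2.2.2 ((oscLambda_neumann_sub_sq_sign hs0 hs x).1 hx)
  · refine strictMonoOn_of_deriv_pos (convex_Ici s) (hc.mono (subset_univ _)) (fun x hx => ?_)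
      self_mem_Ici h.le h
    rw [interior_Ici] at hx
    exact (deriv_oscLambda_neumann_sign n x).1.2 ((oscLambda_neumann_sub_sq_sign hs0 hs x).2 hx)

/-- The factor `η² - λ` of the derivative vanishes at `s` and has slope `2 s` there, because `λ` is
stationary; the other factor need only be continuous. -/
theorem hasDerivAt_deriv_oscLambda_neumann {n : ℕ} {s : ℝ}
    (hs : oscLambda .neumann n s = s ^ 2) :
    HasDerivAt (deriv (oscLambda .neumann n)) (2 * s * neumannTraceSq n s) s := by
  rw [funext (deriv_oscLambda_neumann n)]
  refine (hasDerivAt_mul_of_eq_zero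
    ((hasDerivAt_pow 2 s).fun_sub (hasDerivAt_oscLambda_neumann n s))
    (by rw [hs, sub_self]) (continuous_neumannTraceSq n).continuousAt).congr_deriv ?_
  rw [hs]
  simp

theorem sign_oscLambda_neumann_sub_sq {n : ℕ} {s : ℝ} (hs0 : 0 < s)
    (hs : oscLambda .neumann n s = s ^ 2) (η : ℝ) :
    SignType.sign (oscLambda .neumann n η - η ^ 2) = SignType.sign (s - η) := by
  rcases lt_trichotomy η s with h | rfl | h
  · rw [sign_pos (sub_pos.2 h), sign_pos (sub_pos.2 ((oscLambda_neumann_sub_sq_sign hs0 hs η).1 h))]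
  · rw [hs, sub_self, sub_self]
  · rw [sign_neg (sub_neg.2 h), sign_neg (sub_neg.2 ((oscLambda_neumann_sub_sq_sign hs0 hs η).2 h))]

theorem proposition15 :
    -- the eigenvalues are simple and enumerated increasingly by `oscLambda bc n η`
    (∀ (bc : BoundaryCondition) (η : ℝ),
      StrictMono (fun n : ℕ => oscLambda bc n η) ∧
      Set.range (fun n : ℕ => oscLambda bc n η) = oscEigenvalues bc η ∧
      ∀ n : ℕ, ∃ υ : ℝ → ℝ, IsNormalizedOscEigenfunction bc n η υ ∧
        ∀ w : ℝ → ℝ, IsNormalizedOscEigenfunction bc n η w →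
          Set.EqOn w υ (Set.Iic η) ∨ Set.EqOn w (fun x => -υ x) (Set.Iic η)) ∧
    -- the Dirichlet formula and the sign of the derivative
    (∀ (n : ℕ) (η : ℝ) (υ : ℝ → ℝ),
      IsNormalizedOscEigenfunction BoundaryCondition.dirichlet n η υ →
        HasDerivAt (oscLambda BoundaryCondition.dirichlet n)
          (-|derivWithin υ (Set.Iic η) η| ^ 2) η ∧
        -|derivWithin υ (Set.Iic η) η| ^ 2 < 0) ∧
    -- the Neumann formula
    (∀ (n : ℕ) (η : ℝ) (υ : ℝ → ℝ),
      IsNormalizedOscEigenfunction BoundaryCondition.neumann n η υ →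
        HasDerivAt (oscLambda BoundaryCondition.neumann n)
          ((η ^ 2 - oscLambda BoundaryCondition.neumann n η) * |υ η| ^ 2) η) ∧
    -- the sign of the derivative in the Neumann case
    (∀ (n : ℕ) (η : ℝ),
      (0 < deriv (oscLambda BoundaryCondition.neumann n) η ↔
        oscLambda BoundaryCondition.neumann n η < η ^ 2) ∧
      (deriv (oscLambda BoundaryCondition.neumann n) η = 0 ↔
        oscLambda BoundaryCondition.neumann n η = η ^ 2) ∧
      (deriv (oscLambda BoundaryCondition.neumann n) η < 0 ↔
        η ^ 2 < oscLambda BoundaryCondition.neumann n η)) ∧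
    -- the stationary points `s n` of the Neumann eigenvalues
    (∃ s : ℕ → ℝ,
      (∀ n : ℕ,
        (∀ η : ℝ, deriv (oscLambda BoundaryCondition.neumann n) η = 0 ↔ η = s n) ∧
        (∀ η : ℝ, η ≠ s n →
          oscLambda BoundaryCondition.neumann n (s n) <
            oscLambda BoundaryCondition.neumann n η) ∧
        oscLambda BoundaryCondition.neumann n (s n) = s n ^ 2 ∧
        (∀ υ : ℝ → ℝ, IsNormalizedOscEigenfunction BoundaryCondition.neumann n (s n) υ →
          HasDerivAt (deriv (oscLambda BoundaryCondition.neumann n))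
            (2 * s n * |υ (s n)| ^ 2) (s n) ∧
          0 < 2 * s n * |υ (s n)| ^ 2) ∧
        (∀ η : ℝ, SignType.sign (oscLambda BoundaryCondition.neumann n η - η ^ 2) =
          SignType.sign (s n - η))) ∧
      (∀ n : ℕ, s n < s (n + 1))) := by 
  choose s hs0 hs using exists_sq_eq_oscLambda_neumann
  refine ⟨fun bc η => ⟨(oscLambda_enumeration bc η).1, (oscLambda_enumeration bc η).2.1,
    fun n => exists_isNormalizedOscEigenfunction bc n η⟩,
    fun n η υ h => hasDerivAt_oscLambda_dirichlet h,
    fun n η υ h => ?_, deriv_oscLambda_neumann_sign, s, fun n => ⟨fun η => ?_,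
      fun η hη => oscLambda_neumann_lt_of_ne (hs0 n) (hs n) hη, hs n, fun υ h => ?_,
      sign_oscLambda_neumann_sub_sq (hs0 n) (hs n)⟩, fun n => ?_⟩
  · rw [abs_sq_eq_neumannTraceSq h]
    exact hasDerivAt_oscLambda_neumann n η
  · rw [(deriv_oscLambda_neumann_sign n η).2.1]
    refine ⟨fun h => ?_, fun h => h ▸ hs n⟩
    by_contra hne
    rcases lt_or_gt_of_ne hne with hlt | hlt
    · exact ((oscLambda_neumann_sub_sq_sign (hs0 n) (hs n) η).1 hlt).ne' h
    · exact ((oscLambda_neumann_sub_sq_sign (hs0 n) (hs n) η).2 hlt).ne h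
  · rw [abs_sq_eq_neumannTraceSq h]
    exact ⟨hasDerivAt_deriv_oscLambda_neumann (hs n),
      mul_pos (mul_pos two_pos (hs0 n)) (neumannTraceSq_pos n (s n))⟩
  -- If `s (n + 1) ≤ s n`, the sign rule gives `λ_{n+1} ≤ (s n)² = λ_n` at `s n`, against the strict
  -- order of the eigenvalues.
  · by_contra! hle
    have h1 := (oscLambda_enumeration .neumann (s n)).1 n.lt_succ_self
    simp only [hs n] at h1
    rcases hle.lt_or_eq with hlt | heq
    · exact lt_asymm h1 ((oscLambda_neumann_sub_sq_sign (hs0 (n + 1)) (hs (n + 1)) (s n)).2 hlt)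
    · rw [← heq] at h1
      exact h1.ne' (hs (n + 1))
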